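/- Let $X=(X_t)_{t\ge 0}$ be a Lévy process in $\mathbb{R}^d$ with $X_0=0$, and let $\mathbb{E}^x$ denote expectation for the process started at $x$, i.e. $\mathbb{E}^xF(X)=\mathbb{E}F(x+X)$. $X$ is called a compound Poisson process if its characteristic exponent, defined by $\mathbb{E}e^{i\langle x,X_t\rangle}=e^{-t\psi(x)}$, is of the form $$\psi(x)=-\int_{\mathbb{R}^d}\left(e^{i\langle x,z\rangle}-1\right)\nu(dz)$$ for a finite measure $\nu$ with $\nu(\{0\})=0$ (that is, no Gaussian part, zero drift and finite Lévy measure; $\nu=0$ is allowed), and non-Poisson otherwise. For $\lambda\ge 0$, $t\in(0,\infty]$ and Borel $f\ge0$ put $G_t^\lambda f(x)=\int_0^t e^{-\lambda u}\,\mathbb{E}^x f(X_u)\,du$. Fix $\lambda>0$ and define the following classes of Borel functions $q:\mathbb{R}^d\to\mathbb{R}$: - $\mathbb{K}$: $\lim_{t\to0^+}\sup_{x} G_t^0|q|(x)=0$; - $\mathcal{K}$ (formed with $\lambda$): $\lim_{r\to0^+}\sup_x G_\infty^\lambda\big(\mathbf 1_{B(x,r)}|q|\big)(x)=0$; - $(L^1_{loc})_{uni}(\mathbb{R}^d)$: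 $\sup_x\int_{B(x,1)}|q(z)|\,dz<\infty$; - $B(\mathbb{R}^d)$: $q$ is bounded. Then, for every $\lambda>0$: 1. $\mathcal{K}\subseteq\mathbb{K}\subseteq(L^1_{loc})_{uni}(\mathbb{R}^d)$ for every Lévy process $X$; 2. $B(\mathbb{R}^d)\subseteq\mathbb{K}$ for every Lévy process $X$; 3. $B(\mathbb{R}^d)\subseteq\mathcal{K}$ for every non-Poisson Lévy process $X$; 4. $\mathcal{K}=\{0\}$ (only the function that vanishes at every point) and $\mathbb{K}=B(\mathbb{R}^d)$ for every compound Poisson process $X$. -/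

import Mathlib

open MeasureTheory ProbabilityTheory Filter Set Topology
open scoped NNReal ENNReal

noncomputable section

namespace KatoLevy

/-- The state space `ℝ^d` with its Euclidean norm. -/
abbrev E (d : ℕ) : Type := EuclideanSpace ℝ (Fin d)

section Levy

variable {d : ℕ} {Ω : Type*} [MeasurableSpace Ω]

/-- A Lévy process in `ℝ^d` started at `0`: independent and stationary increments, stochastic
continuity, and almost surely right-continuous paths with left limits. -/
structure IsLevyProcess (P : Measure Ω) (X : ℝ≥0 → Ω → E d) : Prop where
  measurable : ∀ t, Measurable (X t)
  start_zero : ∀ᵐ ω ∂P, X 0 ω = 0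
  indep_increments : HasIndepIncrements X P
  stationary_increments : ∀ s t : ℝ≥0,
    P.map (fun ω => X (s + t) ω - X s ω) = P.map (X t)
  stochastically_continuous : ∀ s : ℝ≥0, TendstoInMeasure P X (𝓝 s) (X s)
  cadlag : ∀ᵐ ω ∂P, ∀ t : ℝ≥0,
    ContinuousWithinAt (fun s => X s ω) (Ici t) t ∧
      ∃ l : E d, Tendsto (fun s => X s ω) (𝓝[<] t) (𝓝 l)

/-- A Lévy measure on `ℝ^d`: no mass at `0` and `∫ (1 ∧ |z|²) ν(dz) < ∞`. -/
structure IsLevyMeasure (ν : Measure (E d)) : Prop where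
  zero_atom : ν {0} = 0
  lintegral_lt_top : (∫⁻ z, min 1 (‖z‖ₑ ^ 2) ∂ν) < ∞

/-- The exponent
`ψ(x) = -i⟨x,γ⟩ + ⟨x,Ax⟩ - ∫ (e^{i⟨x,z⟩} - 1 - i⟨x,z⟩ 1_{|z|<1}) ν(dz)`. -/
def levyExponent (γ : E d) (A : Matrix (Fin d) (Fin d) ℝ) (ν : Measure (E d)) (x : E d) : ℂ :=
  -(Complex.I * (inner ℝ x γ : ℝ)) + (inner ℝ x (Matrix.toEuclideanLin A x) : ℝ)
    - ∫ z, (Complex.exp (Complex.I * (inner ℝ x z : ℝ)) - 1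
        - (Metric.ball (0 : E d) 1).indicator
            (fun y => Complex.I * (inner ℝ x y : ℝ)) z) ∂ν

/-- `X` has the Lévy triplet `(γ, A, ν)`: `𝔼 e^{i⟨x,X_t⟩} = e^{-tψ(x)}`, with `A` symmetric
non-negative definite and `ν` a Lévy measure. -/
structure HasLevyTriplet (P : Measure Ω) (X : ℝ≥0 → Ω → E d)
    (γ : E d) (A : Matrix (Fin d) (Fin d) ℝ) (ν : Measure (E d)) : Prop where
  posSemidef : A.PosSemidef
  levyMeasure : IsLevyMeasure ν
  charFun_eq : ∀ (t : ℝ≥0) (x : E d),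
    charFun (P.map (X t)) x = Complex.exp (-((t : ℝ) : ℂ) * levyExponent γ A ν x)

/-- Compound Poisson process: `ν` is finite, `A = 0`, and the drift
`γ₀ = γ - ∫_{|z|<1} z ν(dz)` vanishes (`ν = 0` is allowed). -/
def IsCompoundPoisson (P : Measure Ω) (X : ℝ≥0 → Ω → E d) : Prop :=
  ∃ (γ : E d) (A : Matrix (Fin d) (Fin d) ℝ) (ν : Measure (E d)),
    HasLevyTriplet P X γ A ν ∧
      (γ - ∫ z in Metric.ball (0 : E d) 1, z ∂ν) = 0 ∧ A = 0 ∧ ν univ < ∞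

/-- `P_t f(x) = 𝔼^x f(X_t) = 𝔼 f(x + X_t)` for `f ≥ 0`. -/
def transitionOp (P : Measure Ω) (X : ℝ≥0 → Ω → E d) (t : ℝ≥0) (f : E d → ℝ≥0∞) (x : E d) :
    ℝ≥0∞ :=
  ∫⁻ ω, f (x + X t ω) ∂P

/-- The truncated potential operator `G_t^lam f(x) = ∫_0^t e^{-lam u} P_u f(x) du`, `t ∈ (0,∞]`,
for `f ≥ 0`. -/
def potentialOp (P : Measure Ω) (X : ℝ≥0 → Ω → E d) (lam : ℝ) (t : ℝ≥0∞) (f : E d → ℝ≥0∞)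
    (x : E d) : ℝ≥0∞ :=
  ∫⁻ u : ℝ in {v : ℝ | 0 < v ∧ ENNReal.ofReal v ≤ t},
    ENNReal.ofReal (Real.exp (-(lam * u))) * transitionOp P X u.toNNReal f x

/-- The Kato class `𝕂(X)` (smallness in time): Borel `q` with
`lim_{t → 0+} sup_x G_t^0 |q|(x) = 0`. -/
def timeKatoClass (P : Measure Ω) (X : ℝ≥0 → Ω → E d) : Set (E d → ℝ) :=
  {q | Measurable q ∧
    Tendsto (fun t : ℝ≥0 => ⨆ x : E d, potentialOp P X 0 t (fun z => ‖q z‖ₑ) x)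
      (𝓝[>] 0) (𝓝 0)}

/-- The Kato class `𝒦(X)` (smallness in space), formed with the parameter `lam > 0`: Borel `q` with
`lim_{r → 0+} sup_x ∫_{B(x,r)} |q(z)| G^lam(x,dz) = 0`. -/
def spaceKatoClass (P : Measure Ω) (X : ℝ≥0 → Ω → E d) (lam : ℝ) : Set (E d → ℝ) :=
  {q | Measurable q ∧
    Tendsto (fun r : ℝ => ⨆ x : E d,
        potentialOp P X lam ∞ ((Metric.ball x r).indicator (fun z => ‖q z‖ₑ)) x)
      (𝓝[>] 0) (𝓝 0)}

end Levy

/-- `(L¹_loc)_uni(ℝ^d)`: Borel `q` with `sup_x ∫_{B(x,1)} |q(z)| dz < ∞`. -/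
def unifLocL1 (d : ℕ) : Set (E d → ℝ) :=
  {q | Measurable q ∧ (⨆ x : E d, ∫⁻ z in Metric.ball x 1, ‖q z‖ₑ) < ∞}

/-- `B(ℝ^d)`: the bounded Borel functions. -/
def boundedBorel (d : ℕ) : Set (E d → ℝ) :=
  {q | Measurable q ∧ ∃ M : ℝ, ∀ x, |q x| ≤ M}

end KatoLevy

end

namespace KatoLevy

/-! Everything depends only on the one-dimensional laws `μ t`, a weakly continuous convolution
semigroup of probability measures.

Bounded functions lie in the time class because the potential up to time `t` has mass `t`. Local
uniform integrability holds because the process stays within distance 1 for a short time with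
probability at least 1/2, so Lebesgue mass on `B(x,1)` is seen by the potential averaged over
`B(x,2)`.

Smallness in space implies smallness in time through `iSup_truncPot_le`: if displacements up to time
`t` exceed `ρ` with probability at most 1/4, the supremum of the potential up to `t` is at most
twice the supremum of its part on `B(x,3ρ)`. The part collected away from `x` is bounded by a
discrete Ottaviani argument, `three_mul_iterSum_le`, using only the semigroup, no paths or stopping
times.

In the compound Poisson case `μ t {0} ≥ exp(-tC)`, so the potential at `x` dominates a positive
multiple of `|q x|`, which settles both classes.

For non-Poisson `X`, a bounded function is in the space class once `μ t {0} = 0` for almost every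
`t`: then `μ t (B(0,r))` decreases to 0 and dominated convergence applies. The hard point is that
charging the origin at uncountably many times forces a compound Poisson process. Symmetrisation
shows that the atoms of `μ u` reach mass 9/10 for all small `u` (`exists_forall_atom`); countability
of the atoms of one law places such an atom at 0 at some positive time (`exists_measure_zero_gt`);
then `2^k μ(t₀/2^k)` off the origin converges to a finite jump measure (`exists_charFun_eq`). -/

/-- A weakly continuous convolution semigroup of probability measures on `ℝ^d`. -/
structure IsConvSemigroup {d : ℕ} (μ : ℝ≥0 → Measure (E d)) : Prop where
  prob : ∀ t, IsProbabilityMeasure (μ t)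
  zero : μ 0 = Measure.dirac 0
  add : ∀ s t, μ (s + t) = μ s ∗ μ t
  continuous : Continuous (Y := ProbabilityMeasure (E d)) fun t => ⟨μ t, prob t⟩

/-! ### Convolution semigroups and their potential operators. -/

section Semigroup

variable {d : ℕ} {Ω : Type*} [MeasurableSpace Ω]

/-- The one-dimensional laws of a Lévy process form a convolution semigroup. -/
theorem IsLevyProcess.isConvSemigroup {P : Measure Ω} [IsProbabilityMeasure P]
    {X : ℝ≥0 → Ω → E d} (hX : IsLevyProcess P X) : IsConvSemigroup fun t => P.map (X t) := by
  refine ⟨fun t => Measure.isProbabilityMeasure_map (hX.measurable t).aemeasurable, ?_, ?_, ?_⟩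
  · rw [Measure.map_congr (g := fun _ => (0 : E d)) hX.start_zero, Measure.map_const]
    simp
  · intro s t
    have hi := hX.indep_increments.indepFun_eval_sub (r := 0) (s := s) (t := s + t)
      (zero_le) (le_self_add) hX.start_zero
    have h := hi.map_add_eq_map_conv_map (hX.measurable s)
      ((hX.measurable (s + t)).sub (hX.measurable s))
    have h2 := hX.stationary_increments s t
    change P.map (X (s + t) - X s) = _ at h2
    rw [h2] at h
    rw [← h]
    simp
  · refine continuous_iff_continuousAt.2 fun s => ?_
    have := (hX.stochastically_continuous s).tendstoInDistribution
      (fun t => (hX.measurable t).aemeasurable)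
    exact this.tendsto

namespace IsConvSemigroup

variable {μ : ℝ≥0 → Measure (E d)} (hμ : IsConvSemigroup μ)
include hμ

/-- Joint measurability in time and space, hence every use of Tonelli below, rests on this. Closed
sets form a generating π-system, and their masses are limits of integrals of thickened indicators,
which are continuous in `t`. -/
theorem measurable : Measurable μ := by
  have := hμ.prob
  refine Measurable.measure_of_isPiSystem_of_isProbabilityMeasure
    (by rw [BorelSpace.measurable_eq (α := E d), borel_eq_generateFrom_isClosed])
    isPiSystem_isClosed ?_
  intro F hF
  obtain ⟨u, -, hu, hul⟩ := exists_seq_strictAnti_tendsto (0 : ℝ)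
  refine measurable_of_tendsto_metrizable (f := fun n t =>
    ∫⁻ x, (thickenedIndicator (hu n) F x : ℝ≥0∞) ∂(μ t)) (fun n => ?_) ?_
  · refine Continuous.measurable ?_
    rw [continuous_iff_continuousAt]
    intro t
    exact (ProbabilityMeasure.tendsto_iff_forall_lintegral_tendsto.1
      (hμ.continuous.tendsto t)) _
  · rw [tendsto_pi_nhds]
    intro t
    exact tendsto_lintegral_thickenedIndicator_of_isClosed (μ t) hF hu hul

theorem tendsto_lintegral (f : BoundedContinuousFunction (E d) ℝ≥0) (t : ℝ≥0) :
    Tendsto (fun s => ∫⁻ x, f x ∂(μ s)) (𝓝 t) (𝓝 (∫⁻ x, f x ∂(μ t))) :=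
  ProbabilityMeasure.tendsto_iff_forall_lintegral_tendsto.1 (hμ.continuous.tendsto t) f

theorem tendsto_charFun (ξ : E d) {u : ℕ → ℝ≥0} {t : ℝ≥0}
    (hu : Tendsto u atTop (𝓝 t)) :
    Tendsto (fun i => charFun (μ (u i)) ξ) atTop (𝓝 (charFun (μ t) ξ)) :=
  ProbabilityMeasure.tendsto_iff_tendsto_charFun.1 ((hμ.continuous.tendsto t).comp hu) ξ

theorem tendsto_measure_compl_ball {r : ℝ} (hr : 0 < r) :
    Tendsto (fun t => μ t (Metric.ball 0 r)ᶜ) (𝓝 0) (𝓝 0) := by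
  have h0 := hμ.tendsto_lintegral (thickenedIndicator hr (Metric.ball (0 : E d) r)ᶜ) 0
  have hz : ∫⁻ x, thickenedIndicator hr (Metric.ball (0 : E d) r)ᶜ x ∂(μ 0) = 0 := by
    rw [hμ.zero, lintegral_dirac, thickenedIndicator_zero hr]
    · rfl
    · intro h
      rw [Metric.mem_thickening_iff] at h
      obtain ⟨z, hz, hz'⟩ := h
      rw [dist_comm] at hz'
      exact hz hz'
  rw [hz] at h0
  refine tendsto_of_tendsto_of_tendsto_of_le_of_le tendsto_const_nhds h0 (fun _ => zero_le) ?_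
  intro t
  exact measure_le_lintegral_thickenedIndicator (μ t) Metric.isOpen_ball.measurableSet.compl hr

theorem exists_forall_measure_compl_ball_le {r : ℝ} (hr : 0 < r) {ε : ℝ≥0∞} (hε : 0 < ε) :
    ∃ t > 0, ∀ s ≤ t, μ s (Metric.ball 0 r)ᶜ ≤ ε := by
  have h := (hμ.tendsto_measure_compl_ball hr).eventually_le_const hε
  obtain ⟨t, ht, h⟩ := Metric.eventually_nhds_iff.1 h
  refine ⟨(t / 2).toNNReal, Real.toNNReal_pos.2 (half_pos ht), fun s hs => h ?_⟩
  have : (s : ℝ) ≤ t / 2 := by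
    rw [← Real.coe_toNNReal (t / 2) (half_pos ht).le]
    exact_mod_cast hs
  rw [NNReal.dist_eq]
  simp
  linarith

end IsConvSemigroup

/-- The transition operator `f ↦ ∫ f(· + y) μ_t(dy)` of a family of measures. -/
noncomputable def transOp (μ : ℝ≥0 → Measure (E d)) (t : ℝ≥0) (f : E d → ℝ≥0∞) (x : E d) : ℝ≥0∞ :=
  ∫⁻ y, f (x + y) ∂(μ t)

/-- The truncated potential operator `f ↦ ∫_0^t T_u f du`. -/
noncomputable def truncPot (μ : ℝ≥0 → Measure (E d)) (t : ℝ≥0) (f : E d → ℝ≥0∞) (x : E d) : ℝ≥0∞ :=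
  ∫⁻ u : ℝ in Ioc 0 (t : ℝ), transOp μ u.toNNReal f x

theorem transitionOp_eq {P : Measure Ω} {X : ℝ≥0 → Ω → E d} (hX : ∀ t, Measurable (X t))
    {f : E d → ℝ≥0∞} (hf : Measurable f) (t : ℝ≥0) (x : E d) :
    transitionOp P X t f x = transOp (fun t => P.map (X t)) t f x := by
  rw [transitionOp, transOp, lintegral_map (by fun_prop) (hX t)]

theorem potentialOp_top_eq {P : Measure Ω} {X : ℝ≥0 → Ω → E d} (hX : ∀ t, Measurable (X t))
    {f : E d → ℝ≥0∞} (hf : Measurable f) (lam : ℝ) (x : E d) :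
    potentialOp P X lam ∞ f x = ∫⁻ u : ℝ in Ioi 0, ENNReal.ofReal (Real.exp (-(lam * u))) *
      transOp (fun t => P.map (X t)) u.toNNReal f x := by
  have h : {v : ℝ | 0 < v ∧ ENNReal.ofReal v ≤ ∞} = Ioi 0 := by ext; simp
  simp_rw [potentialOp, h, transitionOp_eq hX hf]

theorem potentialOp_zero_eq {P : Measure Ω} {X : ℝ≥0 → Ω → E d} (hX : ∀ t, Measurable (X t))
    {f : E d → ℝ≥0∞} (hf : Measurable f) (t : ℝ≥0) (x : E d) :
    potentialOp P X 0 t f x = truncPot (fun t => P.map (X t)) t f x := by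
  have h : {v : ℝ | 0 < v ∧ ENNReal.ofReal v ≤ t} = Ioc 0 (t : ℝ) := by
    ext v
    simp only [mem_ofPred_eq, mem_Ioc, and_congr_right_iff]
    intro _
    rw [← ENNReal.ofReal_coe_nnreal, ENNReal.ofReal_le_ofReal_iff t.coe_nonneg]
  rw [potentialOp, h]
  simp [truncPot, transitionOp_eq hX hf]

theorem transOp_mono (μ : ℝ≥0 → Measure (E d)) (t : ℝ≥0) {f g : E d → ℝ≥0∞} (h : f ≤ g) :
    transOp μ t f ≤ transOp μ t g :=
  fun _ => lintegral_mono fun _ => h _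

theorem truncPot_mono (μ : ℝ≥0 → Measure (E d)) (t : ℝ≥0) {f g : E d → ℝ≥0∞} (h : f ≤ g) :
    truncPot μ t f ≤ truncPot μ t g :=
  fun _ => lintegral_mono fun _ => transOp_mono μ _ h _

theorem truncPot_mono_time (μ : ℝ≥0 → Measure (E d)) {s t : ℝ≥0} (h : s ≤ t)
    (f : E d → ℝ≥0∞) (x : E d) : truncPot μ s f x ≤ truncPot μ t f x :=
  lintegral_mono_set (Ioc_subset_Ioc_right (by exact_mod_cast h))

theorem transOp_add {μ : ℝ≥0 → Measure (E d)} {f g : E d → ℝ≥0∞} (hf : Measurable f)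
    (t : ℝ≥0) (x : E d) : transOp μ t (f + g) x = transOp μ t f x + transOp μ t g x := by
  simp only [transOp, Pi.add_apply]
  rw [lintegral_add_left (by fun_prop)]

theorem transOp_const_mul {μ : ℝ≥0 → Measure (E d)} {f : E d → ℝ≥0∞} (hf : Measurable f)
    (c : ℝ≥0∞) (t : ℝ≥0) (x : E d) :
    transOp μ t (fun y => c * f y) x = c * transOp μ t f x := by
  simp only [transOp]
  rw [lintegral_const_mul _ (by fun_prop)]

namespace IsConvSemigroup

variable {μ : ℝ≥0 → Measure (E d)} (hμ : IsConvSemigroup μ)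
include hμ

theorem measurable_transOp_uncurry {f : E d → ℝ≥0∞} (hf : Measurable f) :
    Measurable fun p : ℝ≥0 × E d => transOp μ p.1 f p.2 := by
  have := hμ.prob
  let κ : Kernel (ℝ≥0 × E d) (E d) := ⟨fun p => μ p.1, hμ.measurable.comp measurable_fst⟩
  have : IsMarkovKernel κ := ⟨fun p => hμ.prob p.1⟩
  have h : Measurable (Function.uncurry fun (p : ℝ≥0 × E d) (y : E d) => f (p.2 + y)) := by
    simp only [Function.uncurry_def]
    fun_prop
  exact h.lintegral_kernel_prod_right (κ := κ)

theorem measurable_transOp {f : E d → ℝ≥0∞} (hf : Measurable f) (t : ℝ≥0) :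
    Measurable (transOp μ t f) :=
  (hμ.measurable_transOp_uncurry hf).comp (measurable_const.prodMk measurable_id)

theorem measurable_transOp_time {f : E d → ℝ≥0∞} (hf : Measurable f) (x : E d) :
    Measurable fun u : ℝ => transOp μ u.toNNReal f x :=
  (hμ.measurable_transOp_uncurry hf).comp (measurable_real_toNNReal.prodMk measurable_const)

theorem measurable_truncPot {f : E d → ℝ≥0∞} (hf : Measurable f) (t : ℝ≥0) :
    Measurable (truncPot μ t f) := by
  have h : Measurable fun p : E d × ℝ => transOp μ p.2.toNNReal f p.1 :=
    (hμ.measurable_transOp_uncurry hf).comp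
      ((measurable_real_toNNReal.comp measurable_snd).prodMk measurable_fst)
  exact h.lintegral_prod_right'

theorem transOp_transOp {f : E d → ℝ≥0∞} (hf : Measurable f) (s t : ℝ≥0) (x : E d) :
    transOp μ s (transOp μ t f) x = transOp μ (s + t) f x := by
  have := hμ.prob
  simp only [transOp]
  rw [hμ.add, Measure.lintegral_conv (by fun_prop)]
  simp [add_assoc]

theorem transOp_le_const {f : E d → ℝ≥0∞} {c : ℝ≥0∞} (h : ∀ x, f x ≤ c) (t : ℝ≥0) (x : E d) :
    transOp μ t f x ≤ c := by
  have := hμ.prob t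
  calc transOp μ t f x ≤ ∫⁻ _, c ∂(μ t) := lintegral_mono fun _ => h _
    _ = c := by simp

theorem transOp_const (c : ℝ≥0∞) (t : ℝ≥0) (x : E d) :
    transOp μ t (fun _ => c) x = c := by
  have := hμ.prob t
  simp [transOp]

theorem truncPot_le_const {f : E d → ℝ≥0∞} {c : ℝ≥0∞} (h : ∀ x, f x ≤ c) (t : ℝ≥0) (x : E d) :
    truncPot μ t f x ≤ c * t := by
  calc truncPot μ t f x ≤ ∫⁻ _ in Ioc 0 (t : ℝ), c :=
        lintegral_mono fun _ => hμ.transOp_le_const h _ _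
    _ = c * t := by simp

/-- This is the Markov property: after time `s` the potential restarts from the position at time
`s`. -/
theorem truncPot_time_add {f : E d → ℝ≥0∞} (hf : Measurable f) (s t : ℝ≥0) (x : E d) :
    truncPot μ (s + t) f x = truncPot μ s f x + transOp μ s (truncPot μ t f) x := by
  have := hμ.prob
  have hm : Measurable fun p : E d × ℝ => transOp μ p.2.toNNReal f p.1 :=
    (hμ.measurable_transOp_uncurry hf).comp
      ((measurable_real_toNNReal.comp measurable_snd).prodMk measurable_fst)
  have h1 : transOp μ s (truncPot μ t f) x
      = ∫⁻ u in Ioc 0 (t : ℝ), transOp μ (s + u.toNNReal) f x := by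
    simp only [← hμ.transOp_transOp hf]
    rw [transOp]
    simp only [truncPot]
    rw [lintegral_lintegral_swap]
    · rfl
    refine Measurable.aemeasurable ?_
    exact hm.comp ((measurable_const.add measurable_fst).prodMk measurable_snd)
  have h2 : ∫⁻ u in Ioc 0 (t : ℝ), transOp μ (s + u.toNNReal) f x
      = ∫⁻ u in Ioc (s : ℝ) (s + t), transOp μ u.toNNReal f x := by
    have hp := measurePreserving_add_left (volume : Measure ℝ) s
    have he : (fun u : ℝ => (s : ℝ) + u) ⁻¹' Ioc (s : ℝ) (s + t) = Ioc 0 (t : ℝ) := by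
      ext; simp
    rw [← hp.setLIntegral_comp_preimage measurableSet_Ioc (hμ.measurable_transOp_time hf x), he]
    refine setLIntegral_congr_fun measurableSet_Ioc fun u hu => ?_
    rw [Real.toNNReal_add s.coe_nonneg hu.1.le, Real.toNNReal_coe]
  rw [h1, h2, truncPot, truncPot, ← lintegral_union measurableSet_Ioc]
  · rw [Ioc_union_Ioc_eq_Ioc s.coe_nonneg (by simp), NNReal.coe_add]
  · exact Set.disjoint_left.2 fun u hu hu' => not_lt.2 hu.2 hu'.1

end IsConvSemigroup
end Semigroup
-- Local uniform integrability and bounded functions.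
section Elementary

variable {d : ℕ} {Ω : Type*} [MeasurableSpace Ω]

namespace IsConvSemigroup

variable {μ : ℝ≥0 → Measure (E d)} (hμ : IsConvSemigroup μ)
include hμ

theorem mul_setLIntegral_ball_le {f : E d → ℝ≥0∞} (hf : Measurable f) (t : ℝ≥0) (x : E d) :
    μ t (Metric.ball 0 1) * ∫⁻ w in Metric.ball x 1, f w
      ≤ ∫⁻ y in Metric.ball x 2, transOp μ t f y := by
  have := hμ.prob
  simp only [transOp]
  rw [lintegral_lintegral_swap (by fun_prop)]
  rw [mul_comm, ← setLIntegral_const]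
  refine (setLIntegral_mono_ae (g := fun z => ∫⁻ y in Metric.ball x 2, f (y + z)) ?_ ?_).trans
    (setLIntegral_le_lintegral _ _)
  · refine Measurable.aemeasurable ?_
    exact Measurable.lintegral_prod_right' (f := fun p : E d × E d => f (p.2 + p.1)) (by fun_prop)
  · refine ae_of_all _ fun z hz => ?_
    have hp := measurePreserving_add_right (volume : Measure (E d)) z
    rw [← hp.setLIntegral_comp_preimage measurableSet_ball hf]
    -- For `‖z‖ < 1`, a point `y` with `y + z` in `B(x,1)` lies in `B(x,2)`.
    refine lintegral_mono_set fun y hy => ?_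
    rw [mem_preimage, mem_ball_iff_norm] at hy
    rw [mem_ball_zero_iff] at hz
    rw [mem_ball_iff_norm]
    calc ‖y - x‖ = ‖(y + z - x) - z‖ := by congr 1; abel
      _ ≤ ‖y + z - x‖ + ‖z‖ := norm_sub_le _ _
      _ < 2 := by linarith

theorem setLIntegral_ball_lt_top {f : E d → ℝ≥0∞} (hf : Measurable f) {t : ℝ≥0} (ht : 0 < t)
    (h : ⨆ x, truncPot μ t f x < ∞) : ⨆ x, ∫⁻ w in Metric.ball x 1, f w < ∞ := by
  have := hμ.prob
  obtain ⟨t₀, ht₀, hb⟩ := hμ.exists_forall_measure_compl_ball_le (r := 1) one_pos (ε := 1 / 2)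
    (by simp)
  -- Up to time `s` the unit ball has mass at least 1/2, which supplies the factor `2⁻¹ * s` after
  -- integration in time.
  set s := min t t₀
  have hs : 0 < s := lt_min ht ht₀
  set S := ⨆ x, truncPot μ t f x with hS
  have key : ∀ x, (∫⁻ w in Metric.ball x 1, f w) * (2⁻¹ * s) ≤
      S * volume (Metric.ball (0 : E d) 2) := by
    intro x
    calc (∫⁻ w in Metric.ball x 1, f w) * (2⁻¹ * s)
        = ∫⁻ _ in Ioc 0 (s : ℝ), 2⁻¹ * ∫⁻ w in Metric.ball x 1, f w := by
          rw [setLIntegral_const, Real.volume_Ioc, sub_zero, ENNReal.ofReal_coe_nnreal]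
          ring
      _ ≤ ∫⁻ u in Ioc 0 (s : ℝ), ∫⁻ y in Metric.ball x 2, transOp μ u.toNNReal f y := by
          refine setLIntegral_mono' measurableSet_Ioc fun u hu => ?_
          refine le_trans ?_ (hμ.mul_setLIntegral_ball_le hf u.toNNReal x)
          gcongr
          have h1 := hb u.toNNReal (Real.toNNReal_le_iff_le_coe.2
            (hu.2.trans (by exact_mod_cast min_le_right t t₀)))
          have h2 := prob_add_prob_compl (μ := μ u.toNNReal)
            (measurableSet_ball (x := (0 : E d)) (ε := 1))
          by_contra! hlt
          have : μ u.toNNReal (Metric.ball 0 1) + μ u.toNNReal (Metric.ball 0 1)ᶜ < 1 := by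
            calc _ < (2⁻¹ : ℝ≥0∞) + 2⁻¹ :=
                  ENNReal.add_lt_add_of_lt_of_le (by finiteness) hlt (by simpa using h1)
              _ = 1 := ENNReal.inv_two_add_inv_two
          exact this.ne h2
      _ = ∫⁻ y in Metric.ball x 2, truncPot μ s f y := by
          simp only [truncPot]
          rw [lintegral_lintegral_swap]
          refine Measurable.aemeasurable ?_
          exact (hμ.measurable_transOp_uncurry hf).comp
            ((measurable_real_toNNReal.comp measurable_fst).prodMk measurable_snd)
      _ ≤ ∫⁻ _ in Metric.ball x 2, S :=
          lintegral_mono fun y => (truncPot_mono_time μ (min_le_left _ _) f y).trans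
            (le_iSup (truncPot μ t f) y)
      _ = S * volume (Metric.ball (0 : E d) 2) := by
          rw [setLIntegral_const, ← Measure.addHaar_ball_center volume x]
  have hc : (2⁻¹ * (s : ℝ≥0∞)) ≠ 0 := by simp [hs.ne']
  have hc' : (2⁻¹ * (s : ℝ≥0∞)) ≠ ∞ := by finiteness
  refine lt_of_le_of_lt (iSup_le fun x => (ENNReal.le_div_iff_mul_le (.inl hc) (.inl hc')).2
    (key x)) ?_
  exact ENNReal.div_lt_top (ENNReal.mul_ne_top h.ne measure_ball_lt_top.ne) hc

end IsConvSemigroup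

variable {P : Measure Ω} [IsProbabilityMeasure P] {X : ℝ≥0 → Ω → E d}

omit [IsProbabilityMeasure P] in
theorem mem_timeKatoClass_iff (hX : IsLevyProcess P X) (q : E d → ℝ) :
    q ∈ timeKatoClass P X ↔ Measurable q ∧ Tendsto (fun t : ℝ≥0 =>
      ⨆ x : E d, truncPot (fun t => P.map (X t)) t (fun z => ‖q z‖ₑ) x) (𝓝[>] 0) (𝓝 0) := by
  refine and_congr_right fun hq => ?_
  simp_rw [potentialOp_zero_eq hX.measurable hq.enorm]

theorem timeKatoClass_subset_unifLocL1 (hX : IsLevyProcess P X) :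
    timeKatoClass P X ⊆ unifLocL1 d := by
  intro q hq
  rw [mem_timeKatoClass_iff hX] at hq
  obtain ⟨hqm, hq⟩ := hq
  obtain ⟨t, ht, htpos⟩ := ((hq.eventually_lt_const one_pos).and self_mem_nhdsWithin).exists
  exact ⟨hqm, hX.isConvSemigroup.setLIntegral_ball_lt_top hqm.enorm htpos
    (ht.trans ENNReal.one_lt_top)⟩

theorem boundedBorel_subset_timeKatoClass (hX : IsLevyProcess P X) :
    boundedBorel d ⊆ timeKatoClass P X := by
  rintro q ⟨hqm, M, hM⟩
  rw [mem_timeKatoClass_iff hX]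
  refine ⟨hqm, ?_⟩
  have h0 : Tendsto (fun t : ℝ≥0 => ENNReal.ofReal M * (t : ℝ≥0∞)) (𝓝[>] 0) (𝓝 0) := by
    have : Tendsto (fun t : ℝ≥0 => ENNReal.ofReal M * (t : ℝ≥0∞)) (𝓝 0)
        (𝓝 (ENNReal.ofReal M * ((0 : ℝ≥0) : ℝ≥0∞))) :=
      ENNReal.Tendsto.const_mul (ENNReal.continuous_coe.tendsto 0) (.inr ENNReal.ofReal_ne_top)
    rw [ENNReal.coe_zero, mul_zero] at this
    exact this.mono_left nhdsWithin_le_nhds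
  refine tendsto_of_tendsto_of_tendsto_of_le_of_le tendsto_const_nhds h0 (fun _ => zero_le) ?_
  intro t
  refine iSup_le fun x => hX.isConvSemigroup.truncPot_le_const (fun y => ?_) t x
  rw [← ofReal_norm]
  exact ENNReal.ofReal_le_ofReal (hM y)

end Elementary
-- Smallness in space implies smallness in time.
section SpaceTime

variable {d : ℕ} {Ω : Type*} [MeasurableSpace Ω]

/-- The sums `∑_{k ≤ n} T_h^k g`, built by recursion on `n`. -/
noncomputable def iterSum (μ : ℝ≥0 → Measure (E d)) (h : ℝ≥0) (g : E d → ℝ≥0∞) :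
    ℕ → E d → ℝ≥0∞
  | 0 => g
  | n + 1 => g + transOp μ h (iterSum μ h g n)

namespace IsConvSemigroup

variable {μ : ℝ≥0 → Measure (E d)} (hμ : IsConvSemigroup μ)
include hμ

theorem measurable_iterSum {g : E d → ℝ≥0∞} (hg : Measurable g) (h : ℝ≥0) (n : ℕ) :
    Measurable (iterSum μ h g n) := by
  induction n with
  | zero => exact hg
  | succ n ih => exact hg.add (hμ.measurable_transOp ih h)

theorem truncPot_succ_mul {f : E d → ℝ≥0∞} (hf : Measurable f) (h : ℝ≥0) (n : ℕ) (x : E d) :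
    truncPot μ (((n + 1 : ℕ) + 1) * h) f x
      = truncPot μ h f x + transOp μ h (truncPot μ ((n + 1) * h) f) x := by
  rw [← hμ.truncPot_time_add hf]
  congr 1
  push_cast
  ring

theorem iterSum_le_truncPot {f g : E d → ℝ≥0∞} (hf : Measurable f) {h : ℝ≥0}
    (hg : g ≤ truncPot μ h f) (n : ℕ) (x : E d) :
    iterSum μ h g n x ≤ truncPot μ ((n + 1) * h) f x := by
  induction n generalizing x with
  | zero => simpa [iterSum] using hg x
  | succ n ih =>
    rw [hμ.truncPot_succ_mul hf, iterSum]
    exact add_le_add (hg x) (transOp_mono μ h ih x)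

/-- Iterates a one-step bound along the skeleton; `T_h` fixes constants, so the errors `c` simply
add up. -/
theorem truncPot_le_iterSum_add {f f' g : E d → ℝ≥0∞} (hf : Measurable f) (hf' : Measurable f')
    (hg : Measurable g) {h : ℝ≥0} {c : ℝ≥0∞}
    (hle : ∀ y, truncPot μ h f y ≤ g y + truncPot μ h f' y + c) (n : ℕ) (y : E d) :
    truncPot μ ((n + 1) * h) f y ≤
      iterSum μ h g n y + truncPot μ ((n + 1) * h) f' y + (n + 1) * c := by
  induction n generalizing y with
  | zero => simpa [iterSum] using hle y
  | succ n ih =>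
    rw [hμ.truncPot_succ_mul hf, hμ.truncPot_succ_mul hf', iterSum]
    have h1 := transOp_mono μ h (g := (iterSum μ h g n + truncPot μ ((n + 1) * h) f') +
      fun _ => (n + 1) * c) ih y
    rw [transOp_add ((hμ.measurable_iterSum hg h n).add (hμ.measurable_truncPot hf' _)),
      transOp_add (hμ.measurable_iterSum hg h n), hμ.transOp_const] at h1
    refine (add_le_add (hle y) h1).trans (le_of_eq ?_)
    simp only [Pi.add_apply]
    push_cast
    ring

/-- A maximal inequality of Ottaviani type for the skeleton of the semigroup. -/
theorem three_mul_iterSum_le {f g : E d → ℝ≥0∞} (hf : Measurable f) {h t : ℝ≥0}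
    (hg : g ≤ truncPot μ h f) {ρ : ℝ} {x : E d}
    (hgs : ∀ y ∈ Metric.ball x (2 * ρ), g y = 0)
    (hs : ∀ s ≤ t, μ s (Metric.ball 0 ρ)ᶜ ≤ 1 / 4) (n : ℕ) (hn : (n + 1) * h ≤ t) (y : E d) :
    3 * iterSum μ h g n y ≤
      4 * (⨆ z, truncPot μ t f z) *
        transOp μ (n * h) ((Metric.ball x ρ)ᶜ.indicator 1) y := by
  have := hμ.prob
  have hD : Measurable ((Metric.ball x ρ)ᶜ.indicator (1 : E d → ℝ≥0∞)) :=
    measurable_one.indicator measurableSet_ball.compl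
  -- From outside `B(x,2ρ)`, entering `B(x,ρ)` requires a displacement of at least `ρ`. The final
  -- position is therefore outside `B(x,ρ)` with probability at least 3/4, the source of the
  -- constants 3 and 4.
  have hfar : ∀ (n : ℕ), (n + 1) * h ≤ t → ∀ y ∉ Metric.ball x (2 * ρ),
      3 * iterSum μ h g n y ≤ 4 * (⨆ z, truncPot μ t f z) *
        transOp μ (n * h) ((Metric.ball x ρ)ᶜ.indicator 1) y := by
    intro n hn y hy
    have h1 : iterSum μ h g n y ≤ ⨆ z, truncPot μ t f z :=
      (hμ.iterSum_le_truncPot hf hg n y).trans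
        ((truncPot_mono_time μ hn f y).trans (le_iSup (truncPot μ t f) y))
    have h2 : μ (n * h) (Metric.ball 0 ρ)ᶜ ≤ 1 / 4 :=
      hs _ (le_trans (by gcongr; simp) hn)
    have h3 : μ (n * h) (Metric.ball 0 ρ) ≤
        transOp μ (n * h) ((Metric.ball x ρ)ᶜ.indicator 1) y := by
      rw [transOp, ← lintegral_indicator_one measurableSet_ball]
      refine lintegral_mono fun z => ?_
      by_cases hz : z ∈ Metric.ball (0 : E d) ρ
      · have hyz : y + z ∈ (Metric.ball x ρ)ᶜ := by
          intro hyz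
          apply hy
          rw [mem_ball_iff_norm] at hyz ⊢
          rw [mem_ball_zero_iff] at hz
          calc ‖y - x‖ = ‖(y + z - x) - z‖ := by congr 1; abel
            _ ≤ ‖y + z - x‖ + ‖z‖ := norm_sub_le _ _
            _ < 2 * ρ := by linarith
        simp only [indicator_of_mem hyz, indicator_of_mem hz, Pi.one_apply, le_refl]
      · simp [indicator_of_notMem hz]
    have h4 : (3 : ℝ≥0∞) ≤ 4 * μ (n * h) (Metric.ball 0 ρ) := by
      have h5 := prob_add_prob_compl (μ := μ (n * h)) (measurableSet_ball (x := (0 : E d)) (ε := ρ))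
      have h6 : 4 * μ (n * h) (Metric.ball 0 ρ)ᶜ ≤ 1 := by
        calc 4 * μ (n * h) (Metric.ball 0 ρ)ᶜ ≤ 4 * (1 / 4) := by gcongr
          _ = 1 := ENNReal.mul_div_cancel (by simp) (by simp)
      have h7 : (3 : ℝ≥0∞) + 1 ≤ 4 * μ (n * h) (Metric.ball 0 ρ) + 1 := by
        calc (3 : ℝ≥0∞) + 1 = 4 * 1 := by norm_num
          _ = 4 * μ (n * h) (Metric.ball 0 ρ) + 4 * μ (n * h) (Metric.ball 0 ρ)ᶜ := by
            rw [← mul_add, h5]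
          _ ≤ _ := by gcongr
      exact (ENNReal.add_le_add_iff_right (by simp)).1 h7
    calc 3 * iterSum μ h g n y
        ≤ (4 * μ (n * h) (Metric.ball 0 ρ)) * ⨆ z, truncPot μ t f z := by gcongr
      _ = 4 * (⨆ z, truncPot μ t f z) * μ (n * h) (Metric.ball 0 ρ) := by ring
      _ ≤ _ := by gcongr
  induction n generalizing y with
  | zero =>
    by_cases hy : y ∈ Metric.ball x (2 * ρ)
    · simp [iterSum, hgs y hy]
    · exact hfar 0 hn y hy
  | succ n ih =>
    by_cases hy : y ∈ Metric.ball x (2 * ρ)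
    -- Inside the ball `g` vanishes, so the sum is `T_h` of the shorter sum, and `T_h` turns the
    -- bound at time `n * h` into the bound at time `(n + 1) * h` with no loss in the constant.
    · have hn' : (n + 1) * h ≤ t := le_trans (by gcongr; simp) hn
      have hm := hμ.measurable_transOp hD (n * h)
      have hgm : Measurable (truncPot μ h f) := hμ.measurable_truncPot hf h
      have h1 := transOp_mono μ h (ih hn') y
      rw [transOp_const_mul hm, hμ.transOp_transOp hD] at h1
      rw [iterSum, Pi.add_apply, hgs y hy, zero_add]
      have h2 : 3 * transOp μ h (iterSum μ h g n) y
          = transOp μ h (fun y => 3 * iterSum μ h g n y) y := by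
        simp only [transOp]
        rw [lintegral_const_mul' _ _ (by simp)]
      rw [h2]
      refine h1.trans (le_of_eq ?_)
      congr 2
      push_cast
      ring
    · exact hfar _ hn y hy

-- From `y` in `B(x,2ρ)`, mass of `f` outside `B(x,3ρ)` is reached within time `h` only by a
-- displacement of at least `ρ`; this costs at most `K * β` per unit of time.
omit hμ in
theorem truncPot_le_local {f : E d → ℝ≥0∞} (hf : Measurable f) {K : ℝ≥0} (hK : ∀ y, f y ≤ K)
    {h : ℝ≥0} {ρ : ℝ} {x : E d} {β : ℝ≥0∞} (hs : ∀ s ≤ h, μ s (Metric.ball 0 ρ)ᶜ ≤ β) (y : E d) :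
    truncPot μ h f y ≤ (Metric.ball x (2 * ρ))ᶜ.indicator (truncPot μ h f) y +
      truncPot μ h ((Metric.ball x (3 * ρ)).indicator f) y + K * β * h := by
  by_cases hy : y ∈ Metric.ball x (2 * ρ)
  · have hfB : Measurable ((Metric.ball x (3 * ρ)).indicator f) := hf.indicator measurableSet_ball
    have h1 : ∀ s ≤ h, transOp μ s f y ≤
        transOp μ s ((Metric.ball x (3 * ρ)).indicator f) y + K * β := by
      intro s hsh
      calc transOp μ s f y
          ≤ ∫⁻ z, ((Metric.ball x (3 * ρ)).indicator f (y + z) +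
              (Metric.ball 0 ρ)ᶜ.indicator (fun _ => (K : ℝ≥0∞)) z) ∂(μ s) := by
            refine lintegral_mono fun z => ?_
            by_cases hz : z ∈ Metric.ball (0 : E d) ρ
            · have hyz : y + z ∈ Metric.ball x (3 * ρ) := by
                rw [mem_ball_iff_norm] at hy ⊢
                rw [mem_ball_zero_iff] at hz
                calc ‖y + z - x‖ = ‖(y - x) + z‖ := by congr 1; abel
                  _ ≤ ‖y - x‖ + ‖z‖ := norm_add_le _ _
                  _ < 3 * ρ := by linarith
              rw [indicator_of_mem hyz]
              exact le_self_add
            · have hz' : z ∈ (Metric.ball (0 : E d) ρ)ᶜ := hz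
              rw [indicator_of_mem hz']
              exact (hK _).trans le_add_self
        _ = transOp μ s ((Metric.ball x (3 * ρ)).indicator f) y +
              K * μ s (Metric.ball 0 ρ)ᶜ := by
            rw [lintegral_add_left (by fun_prop), lintegral_indicator measurableSet_ball.compl,
              setLIntegral_const, transOp]
        _ ≤ _ := by gcongr; exact hs s hsh
    have h2 : truncPot μ h f y ≤ truncPot μ h ((Metric.ball x (3 * ρ)).indicator f) y +
        K * β * h := by
      calc truncPot μ h f y ≤ ∫⁻ u in Ioc 0 (h : ℝ),
            (transOp μ u.toNNReal ((Metric.ball x (3 * ρ)).indicator f) y + K * β) :=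
            setLIntegral_mono' measurableSet_Ioc fun u hu =>
              h1 _ (Real.toNNReal_le_iff_le_coe.2 hu.2)
        _ = _ := by
          rw [lintegral_add_right _ measurable_const, setLIntegral_const, truncPot]
          simp
    refine h2.trans ?_
    rw [add_assoc]
    exact le_add_self
  · have hy' : y ∈ (Metric.ball x (2 * ρ))ᶜ := hy
    rw [indicator_of_mem hy', add_assoc]
    exact le_self_add

/-- At the starting point `x` the exit probability in the maximal inequality is at most 1/4, which
cancels its factor 4. The discretisation error is `K * β * t` over the whole interval and vanishes
as the mesh is refined. -/
theorem three_mul_truncPot_le {f : E d → ℝ≥0∞} (hf : Measurable f) {K : ℝ≥0}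
    (hK : ∀ y, f y ≤ K) {t : ℝ≥0} {ρ : ℝ} (hρ : 0 < ρ)
    (hs : ∀ s ≤ t, μ s (Metric.ball 0 ρ)ᶜ ≤ 1 / 4) (x : E d) :
    3 * truncPot μ t f x ≤ (⨆ z, truncPot μ t f z) +
      3 * truncPot μ t ((Metric.ball x (3 * ρ)).indicator f) x := by
  refine ENNReal.le_of_forall_pos_le_add fun ε hε _ => ?_
  obtain ⟨β, hβ, hβε⟩ : ∃ β : ℝ≥0, 0 < β ∧ 3 * (K * β * t) ≤ ε := by
    -- The added 1 keeps the denominator positive when `K` or `t` is 0.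
    refine ⟨ε / (3 * K * t + 1), by positivity, ?_⟩
    rw [show 3 * (K * (ε / (3 * K * t + 1)) * t) = ε * ((3 * K * t) / (3 * K * t + 1)) by ring]
    exact mul_le_of_le_one_right (by positivity) (div_le_one_of_le₀ (by simp) (by positivity))
  obtain ⟨t₁, ht₁, hb⟩ := hμ.exists_forall_measure_compl_ball_le hρ (ε := β)
    (by exact_mod_cast hβ)
  obtain ⟨n, hn⟩ := exists_nat_gt (t / t₁)
  set h : ℝ≥0 := t / (n + 1) with hh
  have hht : (n + 1) * h = t := by rw [hh]; field_simp
  have hht₁ : h ≤ t₁ := by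
    rw [hh, div_le_iff₀ (by positivity)]
    rw [div_lt_iff₀ ht₁] at hn
    calc t ≤ n * t₁ := hn.le
      _ ≤ t₁ * (n + 1) := by rw [mul_comm]; gcongr; simp
  set B := Metric.ball x (3 * ρ)
  have hfB : Measurable (B.indicator f) := hf.indicator measurableSet_ball
  have hF := hμ.measurable_truncPot hf h
  set g := (Metric.ball x (2 * ρ))ᶜ.indicator (truncPot μ h f) with hg
  have h1 := hμ.truncPot_le_iterSum_add hf hfB (hF.indicator measurableSet_ball.compl)
    (truncPot_le_local hf hK (x := x) fun s hsh => hb s (hsh.trans hht₁)) n x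
  have h2 := hμ.three_mul_iterSum_le hf (g := g) (indicator_le_self _ _)
    (fun y hy => indicator_of_notMem (by simpa using hy) _) hs n hht.le x
  have h3 : transOp μ (n * h) ((Metric.ball x ρ)ᶜ.indicator 1) x ≤ 1 / 4 := by
    refine le_trans (le_of_eq ?_) (hs (n * h) (le_trans (by gcongr; simp) hht.le))
    rw [transOp, ← lintegral_indicator_one measurableSet_ball.compl]
    refine lintegral_congr fun z => ?_
    simp [indicator]
  rw [hht] at h1
  have h4 : (n + 1) * (K * β * h : ℝ≥0∞) = ((K * β * t : ℝ≥0) : ℝ≥0∞) := by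
    rw [← hht]
    push_cast
    ring
  rw [h4] at h1
  have h5 : 3 * iterSum μ h g n x ≤ ⨆ z, truncPot μ t f z := by
    refine h2.trans ?_
    calc _ ≤ 4 * (⨆ z, truncPot μ t f z) * (1 / 4) := by gcongr
      _ = (⨆ z, truncPot μ t f z) * (4 * (1 / 4)) := by ring
      _ = _ := by rw [ENNReal.mul_div_cancel (by simp) (by simp), mul_one]
  calc 3 * truncPot μ t f x
      ≤ 3 * (iterSum μ h g n x + truncPot μ t (B.indicator f) x
          + ((K * β * t : ℝ≥0) : ℝ≥0∞)) := by gcongr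
    _ = 3 * iterSum μ h g n x + 3 * truncPot μ t (B.indicator f) x
          + ((3 * (K * β * t) : ℝ≥0) : ℝ≥0∞) := by push_cast; ring
    _ ≤ _ := by gcongr

theorem truncPot_eq_iSup {f : E d → ℝ≥0∞} (hf : Measurable f) (t : ℝ≥0) (x : E d) :
    truncPot μ t f x = ⨆ n : ℕ, truncPot μ t (fun y => min (f y) n) x := by
  have hmono : ∀ u, Monotone fun n : ℕ => transOp μ u (fun y => min (f y) n) x :=
    fun u m n hmn => transOp_mono μ u (fun y => min_le_min le_rfl (by exact_mod_cast hmn)) x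
  have h1 : ∀ u, transOp μ u f x = ⨆ n : ℕ, transOp μ u (fun y => min (f y) n) x := by
    intro u
    simp only [transOp]
    rw [← lintegral_iSup (f := fun (n : ℕ) y => min (f (x + y)) (n : ℝ≥0∞)) (fun n => by fun_prop)
      (fun m n hmn y => min_le_min le_rfl (by exact_mod_cast hmn))]
    refine lintegral_congr fun y => ?_
    rw [← inf_iSup_eq, ENNReal.iSup_natCast, inf_top_eq]
  simp only [truncPot, h1]
  rw [lintegral_iSup (fun n => hμ.measurable_transOp_time (by fun_prop) x)
    (fun m n hmn u => hmono _ hmn)]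

theorem iSup_truncPot_le {f : E d → ℝ≥0∞} (hf : Measurable f) {t : ℝ≥0} {ρ : ℝ} (hρ : 0 < ρ)
    (hs : ∀ s ≤ t, μ s (Metric.ball 0 ρ)ᶜ ≤ 1 / 4) :
    ⨆ x, truncPot μ t f x ≤ 2 * ⨆ x, truncPot μ t ((Metric.ball x (3 * ρ)).indicator f) x := by
  set A := ⨆ x, truncPot μ t ((Metric.ball x (3 * ρ)).indicator f) x with hA
  refine iSup_le fun x => ?_
  rw [hμ.truncPot_eq_iSup hf]
  refine iSup_le fun n => ?_
  have hfn : Measurable fun y => min (f y) (n : ℝ≥0∞) := by fun_prop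
  set S := ⨆ x, truncPot μ t (fun y => min (f y) n) x with hS
  -- Truncating `f` at level `n` makes `S` finite, so that it can be subtracted from both sides of
  -- `3 * S ≤ S + 3 * A`.
  have hSt : S ≠ ∞ := by
    refine ne_top_of_le_ne_top (b := (n : ℝ≥0∞) * t) (by finiteness) (iSup_le fun x => ?_)
    exact hμ.truncPot_le_const (fun y => min_le_right _ _) t x
  have h1 : ∀ x, 3 * truncPot μ t (fun y => min (f y) n) x ≤ S + 3 * A := by
    intro x
    refine (hμ.three_mul_truncPot_le hfn (K := n) (fun y => by simp) hρ hs x).trans ?_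
    gcongr
    refine le_trans ?_ (le_iSup _ x)
    exact truncPot_mono μ t (g := (Metric.ball x (3 * ρ)).indicator f)
      (fun y => indicator_le_indicator' fun _ => min_le_left _ _) x
  have h2 : 3 * S ≤ S + 3 * A := by
    rw [hS, ENNReal.mul_iSup]
    exact iSup_le h1
  have h3 : 2 * S ≤ 3 * A := by
    rw [show 3 * S = S + 2 * S by ring] at h2
    exact (ENNReal.add_le_add_iff_left hSt).1 h2
  have h4 : 2 * S ≤ 2 * (2 * A) := h3.trans (by
    rw [← mul_assoc]
    gcongr
    norm_num)
  exact (le_iSup (fun x => truncPot μ t (fun y => min (f y) n) x) x).trans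
    ((ENNReal.mul_le_mul_iff_right (by simp) (by simp)).1 h4)

end IsConvSemigroup

variable {P : Measure Ω} [IsProbabilityMeasure P] {X : ℝ≥0 → Ω → E d}

theorem spaceKatoClass_subset_timeKatoClass (hX : IsLevyProcess P X) {lam : ℝ} (hlam : 0 < lam) :
    spaceKatoClass P X lam ⊆ timeKatoClass P X := by
  rintro q ⟨hqm, hq⟩
  have hμ := hX.isConvSemigroup
  rw [mem_timeKatoClass_iff hX]
  refine ⟨hqm, ?_⟩
  have hf : Measurable fun z => ‖q z‖ₑ := hqm.enorm
  rw [ENNReal.tendsto_nhds_zero] at hq ⊢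
  intro ε hε
  -- For `u ≤ 1` the discount satisfies `1 ≤ e^lam * e^{-lam u}`, so times up to 1 can be compared
  -- with the discounted potential.
  set c := ENNReal.ofReal (Real.exp lam) with hc
  have hc0 : c ≠ 0 := by simp [hc, Real.exp_pos]
  have hct : c ≠ ∞ := ENNReal.ofReal_ne_top
  have hδ : 0 < ε / (2 * c) := ENNReal.div_pos hε.ne' (by finiteness)
  obtain ⟨r, hr, hrpos⟩ := ((hq _ hδ).and self_mem_nhdsWithin).exists
  have hρ : 0 < r / 3 := by
    have : (0 : ℝ) < r := hrpos
    positivity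
  obtain ⟨t₀, ht₀, hs⟩ := hμ.exists_forall_measure_compl_ball_le hρ (ε := 1 / 4) (by simp)
  have hev : ∀ᶠ t : ℝ≥0 in 𝓝[>] 0, t ≤ min t₀ 1 :=
    nhdsWithin_le_nhds (eventually_le_nhds (lt_min ht₀ one_pos))
  filter_upwards [hev] with t ht
  refine (hμ.iSup_truncPot_le hf hρ fun s hst => hs s (hst.trans (ht.trans (min_le_left _ _)))).trans
    ?_
  rw [mul_div_cancel₀ r three_ne_zero]
  have hloc : ∀ x, truncPot (fun t => P.map (X t)) t
      ((Metric.ball x r).indicator fun z => ‖q z‖ₑ) x ≤ c * (ε / (2 * c)) := by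
    intro x
    have hfB : Measurable ((Metric.ball x r).indicator fun z => ‖q z‖ₑ) :=
      hf.indicator measurableSet_ball
    have h1 := (le_iSup (fun x => potentialOp P X lam ∞
      ((Metric.ball x r).indicator fun z => ‖q z‖ₑ) x) x).trans hr
    rw [potentialOp_top_eq hX.measurable hfB] at h1
    refine le_trans ?_ (mul_le_mul_right h1 c)
    rw [← lintegral_const_mul' _ _ hct]
    refine le_trans ?_ (lintegral_mono_set (s := Ioc 0 (t : ℝ)) Ioc_subset_Ioi_self)
    refine setLIntegral_mono' measurableSet_Ioc fun u hu => ?_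
    rw [← mul_assoc, hc, ← ENNReal.ofReal_mul (Real.exp_pos _).le, ← Real.exp_add]
    refine le_mul_of_one_le_left' ?_
    rw [ENNReal.one_le_ofReal, Real.one_le_exp_iff]
    have : u ≤ 1 := hu.2.trans (by exact_mod_cast ht.trans (min_le_right _ _))
    nlinarith
  refine (mul_le_mul_right (iSup_le hloc) 2).trans (le_of_eq ?_)
  rw [← mul_assoc, ENNReal.mul_div_cancel (by simp [hc0]) (by finiteness)]

end SpaceTime
-- Compound Poisson processes: mass at the origin and both Kato classes.
section CompoundPoisson

variable {d : ℕ} {Ω : Type*} [MeasurableSpace Ω]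

/-- The convolution powers of a measure. -/
noncomputable def convPow (ν : Measure (E d)) : ℕ → Measure (E d)
  | 0 => Measure.dirac 0
  | n + 1 => ν ∗ convPow ν n

instance isFiniteMeasure_convPow (ν : Measure (E d)) [IsFiniteMeasure ν] (n : ℕ) :
    IsFiniteMeasure (convPow ν n) := by
  induction n with
  | zero => rw [convPow]; infer_instance
  | succ n ih => rw [convPow]; infer_instance

theorem charFun_convPow (ν : Measure (E d)) [IsFiniteMeasure ν] (n : ℕ) (ξ : E d) :
    charFun (convPow ν n) ξ = charFun ν ξ ^ n := by
  induction n with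
  | zero => simp [convPow, charFun_dirac]
  | succ n ih => rw [convPow, charFun_conv, ih, pow_succ']

theorem convPow_univ (ν : Measure (E d)) [IsFiniteMeasure ν] (n : ℕ) :
    convPow ν n univ = ν univ ^ n := by
  induction n with
  | zero => simp [convPow]
  | succ n ih =>
    rw [convPow, Measure.conv, Measure.map_apply (by fun_prop) .univ, preimage_univ,
      ← univ_prod_univ, Measure.prod_prod, ih, pow_succ']

/-- The exponential series `∑ t^n / n! ν^{*n}`. -/
noncomputable def convExp (ν : Measure (E d)) (t : ℝ≥0) : Measure (E d) :=
  Measure.sum fun n : ℕ => (t ^ n / (n.factorial : ℝ≥0)) • convPow ν n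

theorem hasSum_exp_nnreal (x : ℝ≥0) :
    HasSum (fun n : ℕ => x ^ n / (n.factorial : ℝ≥0)) (Real.exp x).toNNReal := by
  rw [← NNReal.hasSum_coe, Real.coe_toNNReal _ (Real.exp_pos _).le, Real.exp_eq_exp_ℝ]
  push_cast
  exact NormedSpace.expSeries_div_hasSum_exp (x : ℝ)

theorem convExp_univ (ν : Measure (E d)) [IsFiniteMeasure ν] (t : ℝ≥0) :
    convExp ν t univ = ((Real.exp (t * (ν univ).toNNReal)).toNNReal : ℝ≥0∞) := by
  rw [convExp, Measure.sum_apply _ .univ]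
  have h := hasSum_exp_nnreal (t * (ν univ).toNNReal)
  rw [NNReal.coe_mul] at h
  rw [← h.tsum_eq, ENNReal.coe_tsum h.summable]
  refine tsum_congr fun n => ?_
  rw [Measure.smul_apply, convPow_univ, ← ENNReal.coe_toNNReal (measure_ne_top ν univ)]
  rw [ENNReal.smul_def, smul_eq_mul, mul_pow]
  rw [← ENNReal.coe_pow, ← ENNReal.coe_mul]
  congr 1
  simp
  ring

instance isFiniteMeasure_convExp (ν : Measure (E d)) [IsFiniteMeasure ν] (t : ℝ≥0) :
    IsFiniteMeasure (convExp ν t) :=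
  ⟨by rw [convExp_univ]; exact ENNReal.coe_lt_top⟩

theorem charFun_convExp (ν : Measure (E d)) [IsFiniteMeasure ν] (t : ℝ≥0) (ξ : E d) :
    charFun (convExp ν t) ξ = Complex.exp (t * charFun ν ξ) := by
  have hint : Integrable (fun z : E d => Complex.exp (inner ℝ z ξ * Complex.I)) (convExp ν t) :=
    (integrable_const (1 : ℝ)).mono (by fun_prop) (by simp [Complex.norm_exp])
  have h1 := hasSum_integral_measure (μ := fun n : ℕ => (t ^ n / (n.factorial : ℝ≥0)) • convPow ν n)
    hint
  have h2 : HasSum (fun n : ℕ => ((t : ℂ) * charFun ν ξ) ^ n / n.factorial)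
      (Complex.exp (t * charFun ν ξ)) := by
    rw [Complex.exp_eq_exp_ℂ]
    exact NormedSpace.expSeries_div_hasSum_exp (t * charFun ν ξ)
  rw [charFun_apply]
  refine h1.unique (h2.congr_fun fun n => ?_)
  rw [integral_smul_nnreal_measure, ← charFun_apply, charFun_convPow, NNReal.smul_def,
    Complex.real_smul]
  push_cast
  ring

theorem integral_exp_sub_one (ν : Measure (E d)) [IsFiniteMeasure ν] (ξ : E d) :
    ∫ z, (Complex.exp (Complex.I * (inner ℝ ξ z : ℝ)) - 1) ∂ν
      = charFun ν ξ - (ν univ).toNNReal := by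
  have hint : Integrable (fun z : E d => Complex.exp (Complex.I * (inner ℝ ξ z : ℝ))) ν :=
    (integrable_const (1 : ℝ)).mono (by fun_prop) (by simp [Complex.norm_exp])
  rw [integral_sub hint (integrable_const _), charFun_apply]
  congr 1
  · simp_rw [real_inner_comm, mul_comm]
  · simp [measureReal_def]
    rfl

theorem levyExponent_of_finite (ν : Measure (E d)) [IsFiniteMeasure ν] (ξ : E d) :
    levyExponent (∫ z in Metric.ball (0 : E d) 1, z ∂ν) 0 ν ξ
      = -∫ z, (Complex.exp (Complex.I * (inner ℝ ξ z : ℝ)) - 1) ∂ν := by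
  have hint : Integrable (fun z : E d => Complex.exp (Complex.I * (inner ℝ ξ z : ℝ))) ν :=
    (integrable_const (1 : ℝ)).mono (by fun_prop) (by simp [Complex.norm_exp])
  have hb : IntegrableOn (fun z : E d => z) (Metric.ball 0 1) ν := by
    refine Measure.integrableOn_of_bounded (M := 1) (measure_ne_top _ _) (by fun_prop) ?_
    exact (ae_restrict_iff' measurableSet_ball).2
      (ae_of_all _ fun z hz => (mem_ball_zero_iff.1 hz).le)
  have hb' : IntegrableOn (fun y : E d => Complex.I * (inner ℝ ξ y : ℝ)) (Metric.ball 0 1) ν :=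
    (((innerSL ℝ ξ).integrable_comp hb).ofReal (𝕜 := ℂ)).const_mul _
  rw [levyExponent, integral_sub (f := fun z => Complex.exp (Complex.I * (inner ℝ ξ z : ℝ)) - 1)
    (hint.sub (integrable_const _))
    ((integrable_indicator_iff measurableSet_ball).2 hb'), integral_indicator measurableSet_ball,
    integral_const_mul, integral_complex_ofReal]
  have h1 : ∫ y in Metric.ball (0 : E d) 1, inner ℝ ξ y ∂ν
      = inner ℝ ξ (∫ z in Metric.ball (0 : E d) 1, z ∂ν) :=
    (innerSL ℝ ξ).integral_comp_comm hb
  rw [h1]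
  simp only [map_zero, LinearMap.zero_apply, inner_zero_right, Complex.ofReal_zero]
  ring

/-- A law with a compound Poisson characteristic function charges the origin. -/
theorem ofReal_exp_neg_le_measure_zero {m ν : Measure (E d)} [IsProbabilityMeasure m]
    [IsFiniteMeasure ν] {t : ℝ≥0}
    (h : ∀ ξ, charFun m ξ = Complex.exp (t * (charFun ν ξ - (ν univ).toNNReal))) :
    ENNReal.ofReal (Real.exp (-(t * (ν univ).toNNReal))) ≤ m {0} := by
  set c : ℝ≥0 := (Real.exp (t * (ν univ).toNNReal)).toNNReal with hc
  -- Both sides have the same characteristic function; the term `n = 0` of the exponential series is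
  -- the Dirac mass at 0, which gives the lower bound.
  have h1 : convExp ν t = c • m := by
    refine Measure.ext_of_charFun (funext fun ξ => ?_)
    rw [charFun_convExp, charFun_apply (μ := c • m), integral_smul_nnreal_measure, ← charFun_apply, h,
      NNReal.smul_def, Complex.real_smul, hc, Real.coe_toNNReal _ (Real.exp_pos _).le,
      Complex.ofReal_exp, ← Complex.exp_add]
    congr 1
    push_cast
    ring
  have h2 : 1 ≤ convExp ν t {0} := by
    rw [convExp, Measure.sum_apply _ (measurableSet_singleton _)]
    refine le_trans ?_ (ENNReal.le_tsum 0)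
    simp [convPow]
  rw [h1, Measure.smul_apply, ENNReal.smul_def, smul_eq_mul] at h2
  have h3 : (ENNReal.ofReal (Real.exp (-(t * (ν univ).toNNReal)))) * c = 1 := by
    rw [hc]
    change _ * ENNReal.ofReal _ = _
    rw [← ENNReal.ofReal_mul (Real.exp_pos _).le, ← Real.exp_add]
    simp
  calc ENNReal.ofReal (Real.exp (-(t * (ν univ).toNNReal)))
      ≤ ENNReal.ofReal (Real.exp (-(t * (ν univ).toNNReal))) * (c * m {0}) :=
        le_mul_of_one_le_right' h2
    _ = m {0} := by rw [← mul_assoc, h3, one_mul]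

variable {P : Measure Ω} [IsProbabilityMeasure P] {X : ℝ≥0 → Ω → E d}

theorem IsCompoundPoisson.exists_exp_le (hX : IsLevyProcess P X) (h : IsCompoundPoisson P X) :
    ∃ C : ℝ, ∀ t : ℝ≥0, ENNReal.ofReal (Real.exp (-(t * C))) ≤ P.map (X t) {0} := by
  obtain ⟨γ, A, ν, hT, hγ, rfl, hν⟩ := h
  have : IsFiniteMeasure ν := ⟨hν⟩
  refine ⟨(ν univ).toNNReal, fun t => ?_⟩
  have := hX.isConvSemigroup.prob t
  refine ofReal_exp_neg_le_measure_zero fun ξ => ?_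
  rw [hT.charFun_eq, sub_eq_zero.1 hγ, levyExponent_of_finite, integral_exp_sub_one]
  congr 1
  push_cast
  ring

theorem mul_measure_zero_le_transOp (μ : ℝ≥0 → Measure (E d)) (t : ℝ≥0) (f : E d → ℝ≥0∞)
    (x : E d) : f x * μ t {0} ≤ transOp μ t f x := by
  calc f x * μ t {0} = ∫⁻ y in {0}, f (x + y) ∂(μ t) := by simp [mul_comm]
    _ ≤ transOp μ t f x := setLIntegral_le_lintegral _ _

theorem IsCompoundPoisson.spaceKatoClass_eq (hX : IsLevyProcess P X) (h : IsCompoundPoisson P X)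
    (lam : ℝ) : spaceKatoClass P X lam = {0} := by
  obtain ⟨C, hC⟩ := h.exists_exp_le hX
  refine Subset.antisymm ?_ ?_
  · rintro q ⟨hqm, hq⟩
    rw [mem_singleton_iff]
    funext x
    set c : ℝ≥0∞ := ∫⁻ u in Ioi (0 : ℝ), ENNReal.ofReal (Real.exp (-(lam * u))) *
      ENNReal.ofReal (Real.exp (-(u * C))) with hc
    have hc0 : 0 < c := by
      rw [hc, setLIntegral_pos_iff (by fun_prop)]
      have : Function.support (fun u : ℝ => ENNReal.ofReal (Real.exp (-(lam * u))) *
          ENNReal.ofReal (Real.exp (-(u * C)))) = univ := by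
        ext u
        simp [Real.exp_pos]
      simp [this]
    -- The centre `x` belongs to every `B(x,r)`, so this lower bound does not shrink with `r`.
    have hle : ∀ᶠ r : ℝ in 𝓝[>] 0, ‖q x‖ₑ * c ≤ ⨆ x : E d,
        potentialOp P X lam ∞ ((Metric.ball x r).indicator (fun z => ‖q z‖ₑ)) x := by
      filter_upwards [self_mem_nhdsWithin] with r hr
      refine le_trans ?_ (le_iSup _ x)
      rw [potentialOp_top_eq hX.measurable (hqm.enorm.indicator measurableSet_ball), hc,
        ← lintegral_const_mul' _ _ (by simp)]
      refine setLIntegral_mono' measurableSet_Ioi fun u hu => ?_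
      rw [mul_left_comm]
      gcongr
      refine le_trans ?_ (mul_measure_zero_le_transOp _ _ _ _)
      rw [indicator_of_mem (Metric.mem_ball_self hr)]
      gcongr
      have := hC u.toNNReal
      rwa [Real.coe_toNNReal u (le_of_lt hu)] at this
    have h0 := ge_of_tendsto hq hle
    simpa [hc0.ne'] using h0
  · rw [singleton_subset_iff]
    refine ⟨measurable_zero, ?_⟩
    simp [potentialOp, transitionOp]

theorem IsCompoundPoisson.timeKatoClass_eq (hX : IsLevyProcess P X) (h : IsCompoundPoisson P X) :
    timeKatoClass P X = boundedBorel d := by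
  refine Subset.antisymm (fun q hq => ?_) (boundedBorel_subset_timeKatoClass hX)
  obtain ⟨C, hC⟩ := h.exists_exp_le hX
  rw [mem_timeKatoClass_iff hX] at hq
  obtain ⟨hqm, hq⟩ := hq
  obtain ⟨t, ht, htpos⟩ := ((hq.eventually_lt_const one_pos).and self_mem_nhdsWithin).exists
  set c : ℝ≥0∞ := ∫⁻ u in Ioc (0 : ℝ) t, ENNReal.ofReal (Real.exp (-(u * C))) with hc
  have hc0 : 0 < c := by
    rw [hc, setLIntegral_pos_iff (by fun_prop)]
    have : Function.support (fun u : ℝ => ENNReal.ofReal (Real.exp (-(u * C)))) = univ := by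
      ext u
      simp [Real.exp_pos]
    simpa [this] using htpos
  have hle : ∀ x, ‖q x‖ₑ ≤ 1 / c := by
    intro x
    have h1 := (le_iSup (fun x => truncPot (fun t => P.map (X t)) t (fun z => ‖q z‖ₑ) x) x).trans
      ht.le
    rw [ENNReal.le_div_iff_mul_le (.inl hc0.ne') (.inr ENNReal.one_ne_top)]
    refine le_trans ?_ h1
    rw [hc, ← lintegral_const_mul' _ _ (by simp)]
    refine setLIntegral_mono' measurableSet_Ioc fun u hu => ?_
    refine le_trans ?_ (mul_measure_zero_le_transOp _ _ _ _)
    gcongr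
    have := hC u.toNNReal
    rwa [Real.coe_toNNReal u hu.1.le] at this
  refine ⟨hqm, (1 / c).toReal, fun x => ?_⟩
  have h2 := ENNReal.toReal_mono (ENNReal.div_ne_top ENNReal.one_ne_top hc0.ne') (hle x)
  simpa using h2

end CompoundPoisson
-- Atoms of symmetrised laws and a large atom at the origin.
section Atoms

variable {d : ℕ}

theorem conv_singleton (μ ν : Measure (E d)) [IsFiniteMeasure μ] [IsFiniteMeasure ν] (x : E d) :
    (μ ∗ ν) {x} = ∫⁻ y, ν {x - y} ∂μ := by
  rw [← lintegral_indicator_one (measurableSet_singleton x),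
    Measure.lintegral_conv (measurable_one.indicator (measurableSet_singleton x))]
  refine lintegral_congr fun y => ?_
  rw [← lintegral_indicator_one (measurableSet_singleton (x - y))]
  refine lintegral_congr fun z => ?_
  have : y + z = x ↔ z = x - y := by rw [eq_sub_iff_add_eq, add_comm]
  simp [indicator, this]

theorem mul_singleton_le_conv (μ ν : Measure (E d)) [IsFiniteMeasure μ] [IsFiniteMeasure ν]
    (x y : E d) : μ {x} * ν {y} ≤ (μ ∗ ν) {x + y} := by
  rw [conv_singleton]
  calc μ {x} * ν {y} = ∫⁻ w in {x}, ν {x + y - w} ∂μ := by simp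
    _ ≤ _ := setLIntegral_le_lintegral _ _

theorem countable_atoms (μ : Measure (E d)) [IsFiniteMeasure μ] :
    {y | 0 < μ {y}}.Countable :=
  Measure.countable_meas_pos_of_disjoint_iUnion (As := fun y : E d => ({y} : Set (E d)))
    (fun _ => measurableSet_singleton _)
    fun _ _ h => by simpa [Function.onFun] using h

theorem lintegral_eq_tsum_singleton (μ : Measure (E d)) {g : E d → ℝ≥0∞}
    (hg : (Function.support g).Countable) : ∫⁻ y, g y ∂μ = ∑' y, g y * μ {y} := by
  rw [← setLIntegral_eq_of_support_subset (s := Function.support g) Subset.rfl]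
  rw [lintegral_countable _ hg]
  exact tsum_subtype_eq_of_support_subset (f := fun y => g y * μ {y})
    fun y hy => left_ne_zero_of_mul hy

/-- The law of `X - X'` for independent `X`, `X'` of law `μ`. -/
noncomputable def symmLaw (μ : Measure (E d)) : Measure (E d) := μ ∗ μ.map (-·)

instance isProbabilityMeasure_symmLaw (μ : Measure (E d)) [IsProbabilityMeasure μ] :
    IsProbabilityMeasure (symmLaw μ) := by
  have : IsProbabilityMeasure (μ.map (-·)) :=
    Measure.isProbabilityMeasure_map measurable_neg.aemeasurable
  rw [symmLaw]
  infer_instance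

theorem symmLaw_singleton (μ : Measure (E d)) [IsProbabilityMeasure μ] (z : E d) :
    symmLaw μ {z} = ∫⁻ y, μ {y - z} ∂μ := by
  have : IsProbabilityMeasure (μ.map (-·)) :=
    Measure.isProbabilityMeasure_map measurable_neg.aemeasurable
  rw [symmLaw, conv_singleton]
  refine lintegral_congr fun y => ?_
  rw [Measure.map_apply measurable_neg (measurableSet_singleton _)]
  congr 1
  ext w
  simp

theorem symmLaw_singleton_eq_tsum (μ : Measure (E d)) [IsProbabilityMeasure μ] (z : E d) :
    symmLaw μ {z} = ∑' y, μ {y + z} * μ {y} := by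
  rw [symmLaw_singleton, lintegral_eq_tsum_singleton]
  · rw [← (Equiv.addRight z).tsum_eq]
    simp [mul_comm]
  · have h := (countable_atoms μ).preimage (sub_left_injective (b := z))
    refine h.mono fun y hy => ?_
    exact pos_iff_ne_zero.2 hy

theorem symmLaw_conv (μ ν : Measure (E d)) [IsProbabilityMeasure μ] [IsProbabilityMeasure ν] :
    symmLaw (μ ∗ ν) = symmLaw μ ∗ symmLaw ν := by
  have : IsProbabilityMeasure (μ.map (-·)) :=
    Measure.isProbabilityMeasure_map measurable_neg.aemeasurable
  have : IsProbabilityMeasure (ν.map (-·)) :=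
    Measure.isProbabilityMeasure_map measurable_neg.aemeasurable
  have h : (μ ∗ ν).map (-·) = μ.map (-·) ∗ ν.map (-·) :=
    Measure.map_conv_addMonoidHom (negAddMonoidHom : E d →+ E d) measurable_neg
  rw [symmLaw, symmLaw, symmLaw, h, Measure.conv_assoc, Measure.conv_assoc,
    ← Measure.conv_assoc ν, Measure.conv_comm ν, Measure.conv_assoc]

/-- The atoms of `symmLaw μ` are the autocorrelations of those of `μ`, and `2ab ≤ a² + b²` puts the
maximum at lag 0. -/
theorem symmLaw_singleton_le (μ : Measure (E d)) [IsProbabilityMeasure μ] (z : E d) :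
    symmLaw μ {z} ≤ symmLaw μ {0} := by
  have h : ∀ a b : ℝ≥0∞, 2 * (a * b) ≤ a * a + b * b := by
    intro a b
    induction a with
    | top => simp
    | coe a =>
      induction b with
      | top => simp
      | coe b =>
        norm_cast
        rw [← NNReal.coe_le_coe]
        push_cast
        nlinarith [sq_nonneg ((a : ℝ) - b)]
  have h2 : 2 * symmLaw μ {z} ≤ 2 * symmLaw μ {0} := by
    simp only [symmLaw_singleton_eq_tsum, add_zero]
    calc 2 * ∑' y, μ {y + z} * μ {y} = ∑' y, 2 * (μ {y + z} * μ {y}) := ENNReal.tsum_mul_left.symm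
      _ ≤ ∑' y, (μ {y + z} * μ {y + z} + μ {y} * μ {y}) := ENNReal.tsum_le_tsum fun y => h _ _
      _ = 2 * ∑' y, μ {y} * μ {y} := by
        rw [ENNReal.tsum_add, two_mul]
        congr 1
        exact (Equiv.addRight z).tsum_eq fun y => μ {y} * μ {y}
  exact (ENNReal.mul_le_mul_iff_right (by simp) (by simp)).1 h2

/-- Doubling inequality for the atoms of a symmetrised law. -/
theorem symmLaw_singleton_doubling (μ : Measure (E d)) [IsProbabilityMeasure μ] (z : E d) :
    4 * symmLaw μ {z} ≤ 3 * symmLaw μ {0} + symmLaw μ {z + z} := by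
  -- This is `(a - 2b + c)² ≥ 0`, a second difference, with negative terms moved across; it is then
  -- summed over `a, b, c = μ {y}, μ {y + z}, μ {y + 2z}`.
  have h : ∀ a b c : ℝ≥0∞, a ≠ ∞ → b ≠ ∞ → c ≠ ∞ →
      4 * (b * a) + 4 * (c * b) ≤ c * c + a * a + 4 * (b * b) + 2 * (c * a) := by
    intro a b c ha hb hc
    lift a to ℝ≥0 using ha
    lift b to ℝ≥0 using hb
    lift c to ℝ≥0 using hc
    norm_cast
    rw [← NNReal.coe_le_coe]
    push_cast
    nlinarith [sq_nonneg ((a : ℝ) + c - 2 * b)]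
  have hs : ∀ w v : E d, ∑' y, μ {y + w} * μ {y + v} = ∑' y, μ {y + (w - v)} * μ {y} := by
    intro w v
    rw [← (Equiv.addRight v).tsum_eq fun y => μ {y + (w - v)} * μ {y}]
    refine tsum_congr fun y => ?_
    simp [add_assoc]
  have h2 : 2 * (4 * symmLaw μ {z}) ≤ 2 * (3 * symmLaw μ {0} + symmLaw μ {z + z}) := by
    simp only [symmLaw_singleton_eq_tsum]
    have h3 := ENNReal.tsum_le_tsum fun y => h (μ {y}) (μ {y + z}) (μ {y + (z + z)})
      (measure_ne_top _ _) (measure_ne_top _ _) (measure_ne_top _ _)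
    simp only [ENNReal.tsum_add, ENNReal.tsum_mul_left] at h3
    rw [hs (z + z) z, hs z z, hs (z + z) (z + z)] at h3
    simp only [add_sub_cancel_right, sub_self, add_zero] at h3 ⊢
    refine (le_of_eq ?_).trans (h3.trans (le_of_eq ?_)) <;> ring
  exact (ENNReal.mul_le_mul_iff_right (by simp) (by simp)).1 h2

theorem symmLaw_real_iterate (μ : Measure (E d)) [IsProbabilityMeasure μ] (z : E d) (k : ℕ) :
    (symmLaw μ).real {0} - (symmLaw μ).real {(2 ^ k : ℝ) • z} ≤
      4 ^ k * ((symmLaw μ).real {0} - (symmLaw μ).real {z}) := by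
  induction k with
  | zero => simp
  | succ k ih =>
    have h := symmLaw_singleton_doubling μ ((2 ^ k : ℝ) • z)
    rw [← two_smul ℝ ((2 ^ k : ℝ) • z), smul_smul, ← pow_succ'] at h
    have h' := ENNReal.toReal_mono (by finiteness) h
    rw [ENNReal.toReal_add (by finiteness) (by finiteness)] at h'
    simp only [ENNReal.toReal_mul, ENNReal.toReal_ofNat] at h'
    simp only [measureReal_def] at ih ⊢
    rw [pow_succ (4 : ℝ)]
    linarith

/-- If a symmetrised law has an atom of intermediate size at `0`, then no other atom is nearly
as large. -/
theorem symmLaw_real_le_of_ne (μ : Measure (E d)) [IsProbabilityMeasure μ] {c : ℝ} {K : ℕ}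
    (hK : 2 < K * c) (hc : c ≤ (symmLaw μ).real {0}) {z : E d} (hz : z ≠ 0) :
    (symmLaw μ).real {z} ≤ (1 - 1 / (2 * 4 ^ K)) * (symmLaw μ).real {0} := by
  set M := (symmLaw μ).real {0} with hM
  by_contra! hlt
  have hM0 : 0 ≤ M := measureReal_nonneg
  -- If the atom at `z` were nearly maximal, the `K` distinct points `2^k • z` would each carry at
  -- least `M / 2`, a total exceeding 1.
  have h1 : ∀ k ∈ Finset.range K, M / 2 ≤ (symmLaw μ).real {(2 ^ k : ℝ) • z} := by
    intro k hk
    have h2 := symmLaw_real_iterate μ z k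
    rw [← hM] at h2
    have h3 : (4 : ℝ) ^ k ≤ 4 ^ K :=
      pow_le_pow_right₀ (by norm_num) (Finset.mem_range.1 hk).le
    have h4 : M - (symmLaw μ).real {z} ≤ 1 / (2 * 4 ^ K) * M := by linarith
    have h5 : (4 : ℝ) ^ k * (M - (symmLaw μ).real {z}) ≤ 4 ^ K * (1 / (2 * 4 ^ K) * M) := by
      calc (4 : ℝ) ^ k * (M - (symmLaw μ).real {z}) ≤ 4 ^ k * (1 / (2 * 4 ^ K) * M) := by gcongr
        _ ≤ _ := by gcongr
    have h6 : (4 : ℝ) ^ K * (1 / (2 * 4 ^ K) * M) = M / 2 := by field_simp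
    linarith
  have hinj : Function.Injective fun k : ℕ => (2 ^ k : ℝ) • z := by
    intro a b hab
    have := smul_left_injective ℝ hz hab
    exact pow_right_injective₀ (by norm_num) (by norm_num) this
  have h2 : ∑ k ∈ Finset.range K, (symmLaw μ).real {(2 ^ k : ℝ) • z} ≤ 1 := by
    have := sum_measureReal_singleton (μ := symmLaw μ)
      ((Finset.range K).map ⟨_, hinj⟩)
    rw [Finset.sum_map] at this
    exact this.le.trans measureReal_le_one
  have h3 := (Finset.sum_le_sum h1).trans h2
  rw [Finset.sum_const, Finset.card_range, nsmul_eq_mul] at h3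
  have : (K : ℝ) * c ≤ K * M := by gcongr
  linarith

theorem conv_self_zero_le (σ : Measure (E d)) [IsProbabilityMeasure σ] {b : ℝ}
    (hb : ∀ z ≠ 0, σ.real {z} ≤ b) :
    (σ ∗ σ).real {0} ≤ σ.real {0} * σ.real {0} + b * (1 - σ.real {0}) := by
  -- A negative `b` is possible only when there is no nonzero point, that is, for `d = 0`.
  have hb0 : 0 ≤ b ∨ σ {0}ᶜ = 0 := by
    by_cases h : σ {0}ᶜ = 0
    · exact .inr h
    · obtain ⟨z, hz⟩ := nonempty_of_measure_ne_zero h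
      exact .inl (measureReal_nonneg.trans (hb z hz))
  have h1 : (σ ∗ σ) {0} ≤ σ {0} * σ {0} + ENNReal.ofReal b * σ {0}ᶜ := by
    rw [conv_singleton, ← lintegral_add_compl _ (measurableSet_singleton (0 : E d))]
    refine add_le_add (by simp) ?_
    rw [← setLIntegral_const]
    refine setLIntegral_mono' (measurableSet_singleton _).compl fun y hy => ?_
    rw [← ENNReal.ofReal_toReal (measure_ne_top σ {0 - y})]
    exact ENNReal.ofReal_le_ofReal (hb _ (by simpa using hy))
  have h2 := ENNReal.toReal_mono (by finiteness) h1
  rw [ENNReal.toReal_add (by finiteness) (by finiteness), ENNReal.toReal_mul,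
    ENNReal.toReal_mul] at h2
  have h3 : σ.real {0}ᶜ = 1 - σ.real {0} := probReal_compl_eq_one_sub (measurableSet_singleton _)
  rw [← h3]
  refine h2.trans ?_
  rw [measureReal_def, measureReal_def]
  refine add_le_add le_rfl ?_
  rcases hb0 with h | h
  · rw [ENNReal.toReal_ofReal h]
  · simp [h]

namespace IsConvSemigroup

variable {μ : ℝ≥0 → Measure (E d)} (hμ : IsConvSemigroup μ)
include hμ

theorem symmLaw_zero_antitone {s t : ℝ≥0} (hst : s ≤ t) :
    symmLaw (μ t) {0} ≤ symmLaw (μ s) {0} := by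
  have := hμ.prob
  obtain ⟨r, rfl⟩ := exists_add_of_le hst
  rw [add_comm, hμ.add, symmLaw_conv, conv_singleton]
  calc ∫⁻ y, symmLaw (μ s) {0 - y} ∂(symmLaw (μ r)) ≤ ∫⁻ _, symmLaw (μ s) {0} ∂(symmLaw (μ r)) :=
        lintegral_mono fun y => symmLaw_singleton_le _ _
    _ = _ := by simp

theorem exists_symmLaw_zero_gt {t : ℝ≥0} (ht : 0 < t) (h : symmLaw (μ t) {0} ≠ 0) :
    ∃ s > 0, 9 / 10 < (symmLaw (μ s)).real {0} := by
  have := hμ.prob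
  by_contra! hle
  set c := (symmLaw (μ t)).real {0} with hc
  have hc0 : 0 < c := by
    rw [hc, measureReal_def]
    exact ENNReal.toReal_pos h (measure_ne_top _ _)
  obtain ⟨K, hK⟩ := exists_nat_gt (2 / c)
  rw [div_lt_iff₀ hc0] at hK
  set δ : ℝ := 1 / (2 * 4 ^ K) with hδ
  have hδ0 : 0 < δ := by positivity
  have hδ1 : δ ≤ 1 := by
    rw [hδ, div_le_one₀ (by positivity)]
    have : (1 : ℝ) ≤ 4 ^ K := one_le_pow₀ (by norm_num)
    linarith
  set x : ℕ → ℝ := fun k => (symmLaw (μ (t / 2 ^ k))).real {0} with hx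
  -- With `x = x (k + 1)`, halving the time gives `x k ≤ x² + (1 - δ) x (1 - x) = x (1 - δ (1 -
  -- x))`, and `1 - x ≥ 1/10` by assumption. Since `c` is fixed, iteration forces `c ≤ 0`.
  have hstep : ∀ k, x k ≤ (1 - δ / 10) * x (k + 1) := by
    intro k
    have hpos : 0 < t / 2 ^ (k + 1) := by positivity
    have hle' := hle _ hpos
    have hcx : c ≤ x (k + 1) := by
      refine ENNReal.toReal_mono (measure_ne_top _ _) (hμ.symmLaw_zero_antitone ?_)
      exact div_le_self (by simp) (one_le_pow₀ (by norm_num))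
    have hx2 : t / 2 ^ k = t / 2 ^ (k + 1) + t / 2 ^ (k + 1) := by
      rw [pow_succ]
      field_simp
      norm_num
    have h1 := conv_self_zero_le (symmLaw (μ (t / 2 ^ (k + 1))))
      fun z hz => symmLaw_real_le_of_ne (μ (t / 2 ^ (k + 1))) hK hcx hz
    rw [← symmLaw_conv, ← hμ.add, ← hx2] at h1
    change x k ≤ x (k + 1) * x (k + 1) + (1 - δ) * x (k + 1) * (1 - x (k + 1)) at h1
    change x (k + 1) ≤ 9 / 10 at hle'
    have h0 : 0 ≤ x (k + 1) := measureReal_nonneg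
    have : 0 ≤ (δ * x (k + 1)) * (9 / 10 - x (k + 1)) :=
      mul_nonneg (by positivity) (by linarith)
    nlinarith
  have hiter : ∀ k, c ≤ (1 - δ / 10) ^ k * x k := by
    intro k
    induction k with
    | zero => simp [hx, hc]
    | succ k ih =>
      refine ih.trans ?_
      rw [pow_succ, mul_assoc]
      have : 0 ≤ 1 - δ / 10 := by linarith
      gcongr
      exact hstep k
  have hlim : Tendsto (fun k : ℕ => (1 - δ / 10) ^ k) atTop (𝓝 0) :=
    tendsto_pow_atTop_nhds_zero_of_lt_one (by linarith) (by linarith)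
  have : c ≤ 0 := by
    refine ge_of_tendsto' hlim fun k => (hiter k).trans ?_
    refine mul_le_of_le_one_right (pow_nonneg (by linarith) k) measureReal_le_one
  linarith

/-- The symmetrised mass at 0 is the `μ u`-average of `μ u {y}`, so it cannot exceed the largest
atom of `μ u`. The large atom need not sit at 0: a drift would move it. -/
theorem exists_forall_atom {t : ℝ≥0} (ht : 0 < t) (h : μ t {0} ≠ 0) :
    ∃ s > 0, ∀ u ≤ s, ∃ z, 9 / 10 < μ u {z} := by
  have := hμ.prob
  have h0 : symmLaw (μ t) {0} ≠ 0 := by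
    rw [symmLaw_singleton_eq_tsum]
    refine ne_of_gt (lt_of_lt_of_le ?_ (ENNReal.le_tsum 0))
    simpa [pos_iff_ne_zero] using h
  obtain ⟨s, hs, hs'⟩ := hμ.exists_symmLaw_zero_gt ht h0
  refine ⟨s, hs, fun u hu => ?_⟩
  by_contra! hle
  have h1 : symmLaw (μ u) {0} ≤ 9 / 10 := by
    rw [symmLaw_singleton]
    calc ∫⁻ y, μ u {y - 0} ∂(μ u) ≤ ∫⁻ _, 9 / 10 ∂(μ u) := lintegral_mono fun y => hle _
      _ = 9 / 10 := by simp
  have h2 := ENNReal.toReal_mono (by finiteness) ((hμ.symmLaw_zero_antitone hu).trans h1)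
  rw [ENNReal.toReal_div] at h2
  simp only [ENNReal.toReal_ofNat] at h2
  rw [measureReal_def] at hs'
  linarith

omit hμ in
theorem eq_of_large_atoms {m : Measure (E d)} [IsProbabilityMeasure m] {x y : E d} {a b : ℝ≥0∞}
    (hx : a ≤ m {x}) (hy : b ≤ m {y}) (hab : 1 < a + b) : x = y := by
  by_contra hxy
  have h1 : m {x} + m {y} = m ({x} ∪ {y}) :=
    (measure_union (by simpa using hxy) (measurableSet_singleton y)).symm
  exact absurd (hab.trans_le ((add_le_add hx hy).trans (h1.le.trans prob_le_one))) (lt_irrefl _)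

omit hμ in
theorem one_lt_sq_add : (1 : ℝ≥0∞) < 9 / 10 * (9 / 10) + 9 / 10 := by
  rw [← ENNReal.toReal_lt_toReal (by finiteness) (by finiteness),
    ENNReal.toReal_add (by finiteness) (by finiteness)]
  norm_num [ENNReal.toReal_mul, ENNReal.toReal_div]

/-- If the semigroup charges the origin at uncountably many times, then at some positive time it
puts most of its mass there. -/
theorem exists_measure_zero_gt (hA : ¬ {t : ℝ≥0 | μ t {0} ≠ 0}.Countable) :
    ∃ s > 0, 9 / 10 < μ s {0} := by
  have := hμ.prob
  set A := {t : ℝ≥0 | μ t {0} ≠ 0} with hAdef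
  obtain ⟨t, htA, ht⟩ : ∃ t ∈ A, 0 < t := by
    by_contra! h
    exact hA ((countable_singleton (0 : ℝ≥0)).mono fun t ht => by simpa using h t ht)
  obtain ⟨s, hs, hz⟩ := hμ.exists_forall_atom ht htA
  choose! z hz using hz
  by_contra! hle
  apply hA
  have hcov : A ⊆ ⋃ n : ℕ, A ∩ Ico (n * s) ((n + 1) * s) := by
    intro u hu
    refine mem_iUnion.2 ⟨⌊u / s⌋₊, hu, ?_, ?_⟩
    · have := Nat.floor_le (a := u / s) (by positivity)
      rwa [le_div_iff₀ hs] at this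
    · have := Nat.lt_floor_add_one (u / s)
      rwa [div_lt_iff₀ hs] at this
  refine (countable_iUnion fun n => ?_).mono hcov
  set T : ℝ≥0 := (n + 1) * s with hT
  have hsub : ∀ u ∈ Ico (n * s) T, T - u ≤ s := by
    intro u hu
    rw [tsub_le_iff_right, hT, add_mul, one_mul, add_comm]
    gcongr
    exact hu.1
  -- For `u ∈ A`, the mass of `μ u` at 0 carries the large atom of `μ (T - u)` into an atom of `μ
  -- T`. Only countably many of these exist, so injectivity in `u` makes this block of `A`
  -- countable.
  refine MapsTo.countable_of_injOn (f := fun u => z (T - u)) (t := {y | 0 < μ T {y}}) ?_ ?_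
    (countable_atoms _)
  · rintro u ⟨huA, hu⟩
    have h1 := mul_singleton_le_conv (μ u) (μ (T - u)) 0 (z (T - u))
    rw [← hμ.add, add_tsub_cancel_of_le hu.2.le, zero_add] at h1
    refine lt_of_lt_of_le (ENNReal.mul_pos huA ?_) h1
    exact ((zero_le).trans_lt (hz _ (hsub u hu))).ne'
  -- Large atoms add under convolution, since `(9/10)² + 9/10 > 1` forces them to coincide. Equal
  -- positions at `T - u` and `T - u'` would then put the large atom of `μ (u' - u)` at 0, contrary
  -- to `hle`.
  · have key : ∀ u u', u ∈ Ico (n * s) T → u' ∈ Ico (n * s) T → u < u' →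
        z (T - u) ≠ z (T - u') := by
      intro u u' hu hu' hlt heq
      have hd : T - u = (T - u') + (u' - u) := by
        rw [tsub_add_tsub_cancel hu'.2.le hlt.le]
      have hdpos : 0 < u' - u := tsub_pos_of_lt hlt
      have hds : u' - u ≤ s := le_trans (by rw [hd]; exact le_add_self) (hsub u hu)
      have h1 := mul_singleton_le_conv (μ (T - u')) (μ (u' - u)) (z (T - u')) (z (u' - u))
      rw [← hμ.add, ← hd] at h1
      have h2 : 9 / 10 * (9 / 10) ≤ μ (T - u) {z (T - u') + z (u' - u)} :=
        le_trans (mul_le_mul' (hz _ (hsub u' hu')).le (hz _ hds).le) h1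
      have h3 := eq_of_large_atoms h2 (hz _ (hsub u hu)).le one_lt_sq_add
      rw [heq] at h3
      have h4 : z (u' - u) = 0 := by simpa using h3
      have h5 := hz _ hds
      rw [h4] at h5
      exact absurd h5 (not_lt.2 (hle _ hdpos))
    rintro u ⟨-, hu⟩ u' ⟨-, hu'⟩ heq
    rcases lt_trichotomy u u' with h | h | h
    · exact absurd heq (key u u' hu hu' h)
    · exact h
    · exact absurd heq.symm (key u' u hu' hu h)

end IsConvSemigroup
end Atoms
-- Recovering a finite jump measure from a large atom at the origin.
section Generator

variable {d : ℕ}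

/-- A decreasing sequence of finite measures converges, tested against bounded functions. -/
theorem exists_limit_of_antitone {α : Type*} [MeasurableSpace α] {m : ℕ → Measure α}
    [hfin : ∀ k, IsFiniteMeasure (m k)] (hm : Antitone m) :
    ∃ ν : Measure α, ν ≤ m 0 ∧ ∀ (g : α → ℂ) (C : ℝ), Measurable g → (∀ x, ‖g x‖ ≤ C) →
      Tendsto (fun k => ∫ x, g x ∂(m k)) atTop (𝓝 (∫ x, g x ∂ν)) := by
  have hac : ∀ k, m k ≪ m 0 := fun k => (hm (Nat.zero_le k)).absolutelyContinuous
  set f : ℕ → α → ℝ≥0∞ := fun k => (m k).rnDeriv (m 0) with hf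
  have hfm : ∀ k, Measurable (f k) := fun k => Measure.measurable_rnDeriv _ _
  have hfd : ∀ k, (m 0).withDensity (f k) = m k := fun k => Measure.withDensity_rnDeriv_eq _ _ (hac k)
  -- The densities with respect to `m 0` decrease almost everywhere; their infimum is the density of
  -- the limit, and dominated convergence does the rest.
  have hanti : ∀ᵐ x ∂(m 0), Antitone fun k => f k x := by
    have : ∀ᵐ x ∂(m 0), ∀ k, f (k + 1) x ≤ f k x := by
      rw [ae_all_iff]
      intro k
      refine ae_le_of_forall_setLIntegral_le_of_sigmaFinite (hfm _) fun s hs _ => ?_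
      rw [← withDensity_apply _ hs, ← withDensity_apply _ hs, hfd, hfd]
      exact hm (Nat.le_succ k) s
    filter_upwards [this] with x hx using antitone_nat_of_succ_le hx
  have hlt : ∀ᵐ x ∂(m 0), ∀ k, f k x < ∞ := by
    rw [ae_all_iff]
    exact fun k => Measure.rnDeriv_lt_top _ _
  have hFm : Measurable fun x => ⨅ k, f k x := Measurable.iInf hfm
  refine ⟨(m 0).withDensity fun x => ⨅ k, f k x, ?_, ?_⟩
  · conv_rhs => rw [← hfd 0]
    exact withDensity_mono (ae_of_all _ fun x => iInf_le _ 0)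
  · intro g C hg hC
    rw [integral_withDensity_eq_integral_toReal_smul hFm
      (by filter_upwards [hlt] with x hx using (iInf_le _ 0).trans_lt (hx 0))]
    have h1 : ∀ k, ∫ x, g x ∂(m k) = ∫ x, (f k x).toReal • g x ∂(m 0) := by
      intro k
      rw [← integral_withDensity_eq_integral_toReal_smul (hfm k)
        (by filter_upwards [hlt] with x hx using hx k), hfd]
    simp_rw [h1]
    refine tendsto_integral_of_dominated_convergence (fun x => (f 0 x).toReal * C)
      (fun k => ((hfm k).ennreal_toReal.smul hg).aestronglyMeasurable) ?_ (fun k => ?_) ?_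
    · exact Measure.integrable_toReal_rnDeriv.mul_const C
    · filter_upwards [hanti, hlt] with x hx hx'
      rw [norm_smul, Real.norm_of_nonneg ENNReal.toReal_nonneg]
      gcongr
      · exact (hx' 0).ne
      · exact hx (Nat.zero_le k)
      · exact hC x
    · filter_upwards [hanti, hlt] with x hx hx'
      refine Tendsto.smul_const ?_ _
      exact (ENNReal.tendsto_toReal ((iInf_le _ 0).trans_lt (hx' 0)).ne).comp
        (tendsto_atTop_iInf hx)

theorem tendsto_one_add_pow_exp {g : ℕ → ℂ} {m : ℕ → ℕ} {w : ℂ} (hg : Tendsto g atTop (𝓝 0))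
    (hm : Tendsto (fun k => (m k : ℂ) * g k) atTop (𝓝 w)) :
    Tendsto (fun k => (1 + g k) ^ m k) atTop (𝓝 (Complex.exp w)) := by
  have hlog : Tendsto (fun k => (m k : ℂ) * Complex.log (1 + g k)) atTop (𝓝 w) := by
    have hdiff : Tendsto (fun k => (m k : ℂ) * (Complex.log (1 + g k) - g k)) atTop (𝓝 0) := by
      have hb : Tendsto (fun k => ‖(m k : ℂ) * g k‖ * ‖g k‖) atTop (𝓝 0) := by
        have := hm.norm.mul hg.norm
        simpa using this
      refine squeeze_zero_norm' ?_ hb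
      have hev : ∀ᶠ k in atTop, ‖g k‖ < 1 / 2 := by
        have := hg.norm
        rw [norm_zero] at this
        exact this.eventually_lt_const (by norm_num)
      filter_upwards [hev] with k hk
      have h1 := Complex.norm_log_one_add_sub_self_le (z := g k) (by linarith)
      have h2 : (1 - ‖g k‖)⁻¹ ≤ 2 := by
        rw [inv_le_comm₀ (by linarith) (by norm_num)]
        linarith
      rw [norm_mul, norm_mul, mul_assoc]
      gcongr
      calc _ ≤ ‖g k‖ ^ 2 * (1 - ‖g k‖)⁻¹ / 2 := h1
        _ ≤ ‖g k‖ ^ 2 * 2 / 2 := by gcongr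
        _ = ‖g k‖ * ‖g k‖ := by ring
    have := hdiff.add hm
    rw [zero_add] at this
    refine this.congr fun k => ?_
    ring
  refine ((Complex.continuous_exp.tendsto w).comp hlog).congr' ?_
  have hne : ∀ᶠ k in atTop, 1 + g k ≠ 0 := by
    have : Tendsto (fun k => 1 + g k) atTop (𝓝 (1 + 0)) := hg.const_add 1
    exact this.eventually_ne (by simp)
  filter_upwards [hne] with k hk
  simp only [Function.comp_apply]
  rw [Complex.exp_nat_mul, Complex.exp_log hk]

theorem conv_self_zero_le_sq (m : Measure (E d)) [IsProbabilityMeasure m] :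
    (m ∗ m).real {0} ≤ m.real {0} * m.real {0} + (1 - m.real {0}) * (1 - m.real {0}) := by
  refine conv_self_zero_le m fun z hz => ?_
  have h : m.real {0}ᶜ = 1 - m.real {0} := probReal_compl_eq_one_sub (measurableSet_singleton _)
  rw [← h]
  exact measureReal_mono (by simpa using hz.symm)

/-- Two disjoint ways of landing in `B`: one summand is 0 and the other lies in `B`. -/
theorem two_mul_le_conv_self (m : Measure (E d)) [IsProbabilityMeasure m] {B : Set (E d)}
    (hB : MeasurableSet B) (h0 : 0 ∉ B) : 2 * (m {0} * m B) ≤ (m ∗ m) B := by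
  have h1 : (m ∗ m) B = ∫⁻ y, m {z | y + z ∈ B} ∂m := by
    rw [← lintegral_indicator_one hB, Measure.lintegral_conv (measurable_one.indicator hB)]
    refine lintegral_congr fun y => ?_
    exact lintegral_indicator_one (μ := m) ((measurable_const_add y) hB)
  rw [h1]
  have hd : Disjoint ({0} : Set (E d)) B := by simpa using h0
  calc 2 * (m {0} * m B) = m B * m {0} + m {0} * m B := by ring
    _ ≤ (∫⁻ y in {0}, m {z | y + z ∈ B} ∂m) + ∫⁻ y in B, m {z | y + z ∈ B} ∂m := by
      refine add_le_add (by simp [mul_comm]) ?_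
      rw [← setLIntegral_const]
      refine setLIntegral_mono' hB fun y hy => measure_mono ?_
      simpa using hy
    _ = ∫⁻ y in {0} ∪ B, m {z | y + z ∈ B} ∂m := (lintegral_union hB hd).symm
    _ ≤ _ := setLIntegral_le_lintegral _ _

namespace IsConvSemigroup

variable {μ : ℝ≥0 → Measure (E d)} (hμ : IsConvSemigroup μ)
include hμ

theorem charFun_nat_mul (s : ℝ≥0) (n : ℕ) (ξ : E d) :
    charFun (μ (n * s)) ξ = charFun (μ s) ξ ^ n := by
  have := hμ.prob
  induction n with
  | zero => simp [hμ.zero, charFun_dirac]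
  | succ n ih =>
    rw [Nat.cast_succ, add_mul, one_mul, hμ.add, charFun_conv, ih, pow_succ]

/-- A convolution square has no atom larger than the largest atom of its factor, so `μ s` has an
atom `z` of mass above 9/10; then `2z` and 0 are both large atoms of `μ (s + s)`, hence `z = 0`. -/
theorem measure_half_zero_gt {s : ℝ≥0} (h : 9 / 10 < μ (s + s) {0}) : 9 / 10 < μ s {0} := by
  have := hμ.prob
  obtain ⟨z, hz⟩ : ∃ z, 9 / 10 < μ s {z} := by
    by_contra! hle
    refine absurd h (not_lt.2 ?_)
    rw [hμ.add, conv_singleton]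
    calc ∫⁻ y, μ s {0 - y} ∂(μ s) ≤ ∫⁻ _, 9 / 10 ∂(μ s) := lintegral_mono fun y => hle _
      _ = 9 / 10 := by simp
  have h1 := mul_singleton_le_conv (μ s) (μ s) z z
  rw [← hμ.add] at h1
  have h2 := eq_of_large_atoms ((mul_le_mul' hz.le hz.le).trans h1) h.le one_lt_sq_add
  have h3 : z = 0 := by
    rw [← two_smul ℝ z] at h2
    simpa using h2
  rwa [h3] at hz

omit hμ in
theorem dyadic_add (t : ℝ≥0) (k : ℕ) :
    t / 2 ^ (k + 1) + t / 2 ^ (k + 1) = t / 2 ^ k := by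
  rw [pow_succ]
  field_simp
  norm_num

theorem dyadic_measure_zero {t : ℝ≥0} (h : 9 / 10 < μ t {0}) (k : ℕ) :
    9 / 10 < μ (t / 2 ^ k) {0} ∧ 1 - (1 / 10) * (2 / 3 : ℝ) ^ k ≤ (μ (t / 2 ^ k)).real {0} := by
  have := hμ.prob
  have hreal : ∀ s, 9 / 10 < μ s {0} → 9 / 10 < (μ s).real {0} := by
    intro s hs
    have := ENNReal.toReal_strict_mono (measure_ne_top _ _) hs
    rw [ENNReal.toReal_div] at this
    simpa [measureReal_def] using this
  induction k with
  | zero =>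
    have := hreal t h
    simp only [pow_zero, div_one]
    exact ⟨h, by linarith⟩
  | succ k ih =>
    obtain ⟨ih1, ih2⟩ := ih
    rw [← dyadic_add] at ih1
    have h1 := hμ.measure_half_zero_gt ih1
    refine ⟨h1, ?_⟩
    have h2 := conv_self_zero_le_sq (μ (t / 2 ^ (k + 1)))
    rw [← hμ.add, dyadic_add] at h2
    have h3 := hreal _ h1
    have h4 : (μ (t / 2 ^ (k + 1))).real {0} ≤ 1 := measureReal_le_one
    rw [pow_succ]
    -- With `e = 1 - μ(t/2^(k+1)) {0} < 1/10`, the bound `h2` says that `2e(1 - e)` is at most the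
    -- previous defect, so the defect shrinks by at least 5/9, hence by 2/3.
    nlinarith

/-- If the semigroup puts most of its mass at the origin at some positive time, it is the
compound Poisson semigroup of a finite measure. -/
theorem exists_charFun_eq {t₀ : ℝ≥0} (ht₀ : 0 < t₀) (h : 9 / 10 < μ t₀ {0}) :
    ∃ ν : Measure (E d), IsFiniteMeasure ν ∧ ν {0} = 0 ∧ ∀ (t : ℝ≥0) (ξ : E d),
      charFun (μ t) ξ =
        Complex.exp (t * ∫ z, (Complex.exp (Complex.I * (inner ℝ ξ z : ℝ)) - 1) ∂ν) := by
  have := hμ.prob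
  set s : ℕ → ℝ≥0 := fun k => t₀ / 2 ^ k with hs
  -- The factor `1 + (2/3)^k` tends to 1 and is chosen to make the measures `m k` decrease: by
  -- `two_mul_le_conv_self` the plain scaling `2^k` falls short of monotonicity only by the mass at
  -- 0, whose defect is at most `(1/10) * (2/3)^(k+1)`.
  set c : ℕ → ℝ≥0 := fun k => (1 + (2 / 3) ^ k) * 2 ^ k with hc
  set m : ℕ → Measure (E d) := fun k => c k • (μ (s k)).restrict {0}ᶜ with hm
  have hanti : Antitone m := by
    refine antitone_nat_of_succ_le fun k => ?_
    refine Measure.le_iff.2 fun B hB => ?_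
    simp only [hm, Measure.smul_apply, Measure.restrict_apply hB]
    have hB' : MeasurableSet (B ∩ {0}ᶜ) := hB.inter (measurableSet_singleton _).compl
    have h1 := two_mul_le_conv_self (μ (s (k + 1))) hB' (by simp)
    rw [← hμ.add, dyadic_add] at h1
    change 2 * (_ * _) ≤ μ (s k) (B ∩ {0}ᶜ) at h1
    set a := μ (s (k + 1)) {0} with ha
    have h2 : 1 + (2 / 3 : ℝ≥0∞) ^ (k + 1) ≤ (1 + (2 / 3 : ℝ≥0∞) ^ k) * a := by
      have h3 := (hμ.dyadic_measure_zero h (k + 1)).2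
      rw [← ENNReal.toReal_le_toReal (by finiteness) (by finiteness), ENNReal.toReal_mul,
        ENNReal.toReal_add (by finiteness) (by finiteness),
        ENNReal.toReal_add (by finiteness) (by finiteness)]
      change _ ≤ _ * (μ (t₀ / 2 ^ (k + 1))).real {0}
      have hx : (0 : ℝ) ≤ (2 / 3) ^ k := by positivity
      have hx1 : ((2 / 3) ^ k : ℝ) ≤ 1 := pow_le_one₀ (by norm_num) (by norm_num)
      have h4 : (1 + (2 / 3 : ℝ) ^ (k + 1)) ≤ (1 + (2 / 3 : ℝ) ^ k) *
          (μ (t₀ / 2 ^ (k + 1))).real {0} := by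
        refine le_trans ?_ (mul_le_mul_of_nonneg_left h3 (by positivity))
        rw [pow_succ]
        nlinarith
      simpa [ENNReal.toReal_pow, ENNReal.toReal_div] using h4
    simp only [ENNReal.smul_def, smul_eq_mul, hc]
    push_cast
    calc (1 + (2 / 3 : ℝ≥0∞) ^ (k + 1)) * 2 ^ (k + 1) * μ (s (k + 1)) (B ∩ {0}ᶜ)
        ≤ ((1 + (2 / 3 : ℝ≥0∞) ^ k) * a) * 2 ^ (k + 1) * μ (s (k + 1)) (B ∩ {0}ᶜ) := by gcongr
      _ = (1 + (2 / 3 : ℝ≥0∞) ^ k) * 2 ^ k * (2 * (a * μ (s (k + 1)) (B ∩ {0}ᶜ))) := by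
        rw [pow_succ]; ring
      _ ≤ _ := by gcongr
  obtain ⟨ν', hν', hlim⟩ := exists_limit_of_antitone hanti
  have hν'fin : IsFiniteMeasure ν' := isFiniteMeasure_of_le _ hν'
  refine ⟨t₀⁻¹ • ν', inferInstance, ?_, fun t ξ => ?_⟩
  · have h1 : m 0 {0} = 0 := by simp [hm]
    have h2 : ν' {0} = 0 := le_antisymm ((hν' _).trans h1.le) zero_le
    simp [h2]
  set g : E d → ℂ := fun z => Complex.exp (Complex.I * (inner ℝ ξ z : ℝ)) - 1 with hg
  have hgm : Measurable g := by fun_prop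
  have hgb : ∀ z, ‖g z‖ ≤ 2 := by
    intro z
    refine (norm_sub_le _ _).trans ?_
    rw [mul_comm, Complex.norm_exp_ofReal_mul_I]
    norm_num
  have hgi : ∀ k, charFun (μ (s k)) ξ - 1 = ∫ z in {0}ᶜ, g z ∂(μ (s k)) := by
    intro k
    have h1 := integral_exp_sub_one (μ (s k)) ξ
    simp only [measure_univ, ENNReal.toNNReal_one, NNReal.coe_one, Complex.ofReal_one] at h1
    rw [← h1, setIntegral_eq_integral_of_forall_compl_eq_zero]
    intro z hz
    have : z = 0 := by simpa using hz
    simp [hg, this]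
  have hw : Tendsto (fun k => (2 : ℂ) ^ k * (charFun (μ (s k)) ξ - 1)) atTop
      (𝓝 (∫ z, g z ∂ν')) := by
    have h1 := hlim g 2 hgm hgb
    have h2 : Tendsto (fun k : ℕ => ((1 + (2 / 3 : ℂ) ^ k))⁻¹) atTop (𝓝 1) := by
      have h3 : Tendsto (fun k : ℕ => (2 / 3 : ℂ) ^ k) atTop (𝓝 0) :=
        tendsto_pow_atTop_nhds_zero_of_norm_lt_one (by norm_num)
      have h4 := (h3.const_add 1).inv₀ (by simp)
      simpa [ENNReal.toReal_pow, ENNReal.toReal_div] using h4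
    have h5 := h2.mul h1
    rw [one_mul] at h5
    refine h5.congr fun k => ?_
    have hne : (1 + (2 / 3 : ℂ) ^ k) ≠ 0 := by
      have : (1 + (2 / 3 : ℂ) ^ k) = ((1 + (2 / 3 : ℝ) ^ k : ℝ) : ℂ) := by push_cast; rfl
      rw [this, Complex.ofReal_ne_zero]
      positivity
    simp only [hm, hc]
    rw [integral_smul_nnreal_measure, ← hgi, NNReal.smul_def, Complex.real_smul]
    push_cast
    field_simp
  have h0 : Tendsto (fun k => charFun (μ (s k)) ξ - 1) atTop (𝓝 0) := by
    have h1 : Tendsto (fun k : ℕ => (1 / 2 : ℂ) ^ k) atTop (𝓝 0) :=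
      tendsto_pow_atTop_nhds_zero_of_norm_lt_one (by norm_num)
    have h2 := h1.mul hw
    rw [zero_mul] at h2
    refine h2.congr fun k => ?_
    rw [← mul_assoc, ← mul_pow]
    norm_num
  -- `n k` steps of length `t₀ / 2^k` approximate `t`, so the characteristic function at `t` is a
  -- limit of integer powers and no choice of complex logarithm along the semigroup is needed.
  set n : ℕ → ℕ := fun k => ⌊(t / t₀ : ℝ) * 2 ^ k⌋₊ with hn
  have hnR : Tendsto (fun k => (n k : ℝ) / 2 ^ k) atTop (𝓝 (t / t₀)) :=
    (tendsto_nat_floor_mul_div_atTop (R := ℝ) (a := t / t₀) (by positivity)).comp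
      (tendsto_pow_atTop_atTop_of_one_lt (r := (2 : ℝ)) (by norm_num))
  have hne : (t₀ : ℝ) ≠ 0 := by exact_mod_cast ht₀.ne'
  have htime : Tendsto (fun k => (n k : ℝ≥0) * s k) atTop (𝓝 t) := by
    rw [← NNReal.tendsto_coe]
    have h1 := hnR.mul_const (t₀ : ℝ)
    rw [div_mul_cancel₀ _ hne] at h1
    refine h1.congr fun k => ?_
    simp only [hs]
    push_cast
    ring
  have hpow := tendsto_one_add_pow_exp (m := n) (w := (t / t₀ : ℝ) * ∫ z, g z ∂ν') h0 (by
    refine (((Complex.continuous_ofReal.tendsto _).comp hnR).mul hw).congr fun k => ?_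
    simp only [Function.comp_apply]
    push_cast
    field_simp)
  have hlhs := hμ.tendsto_charFun ξ htime
  simp only [hμ.charFun_nat_mul] at hlhs
  simp only [add_sub_cancel] at hpow
  rw [tendsto_nhds_unique hlhs hpow, integral_smul_nnreal_measure, NNReal.smul_def,
    Complex.real_smul]
  congr 1
  push_cast
  ring

end IsConvSemigroup
end Generator
-- Bounded functions for non-Poisson processes.
section NonPoisson

variable {d : ℕ} {Ω : Type*} [MeasurableSpace Ω]
  {P : Measure Ω} [IsProbabilityMeasure P] {X : ℝ≥0 → Ω → E d}

/-- A Lévy process that charges the origin at uncountably many times is compound Poisson. -/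
theorem isCompoundPoisson_of_not_countable (hX : IsLevyProcess P X)
    (h : ¬ {t : ℝ≥0 | P.map (X t) {0} ≠ 0}.Countable) : IsCompoundPoisson P X := by
  have hμ := hX.isConvSemigroup
  obtain ⟨s, hs, hs'⟩ := hμ.exists_measure_zero_gt h
  obtain ⟨ν, hν, hν0, hchar⟩ := hμ.exists_charFun_eq hs hs'
  refine ⟨∫ z in Metric.ball (0 : E d) 1, z ∂ν, 0, ν, ⟨Matrix.PosSemidef.zero, ⟨hν0, ?_⟩, ?_⟩,
    sub_self _, rfl, measure_lt_top _ _⟩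
  · calc ∫⁻ z, min 1 (‖z‖ₑ ^ 2) ∂ν ≤ ∫⁻ _, 1 ∂ν := lintegral_mono fun z => min_le_left _ _
      _ < ∞ := by simp
  · intro t x
    rw [hchar, levyExponent_of_finite]
    congr 1
    ring

theorem tendsto_setLIntegral_measure_ball (hX : IsLevyProcess P X)
    (h : {t : ℝ≥0 | P.map (X t) {0} ≠ 0}.Countable) {lam : ℝ} (hlam : 0 < lam) :
    Tendsto (fun r : ℝ => ∫⁻ u in Ioi (0 : ℝ), ENNReal.ofReal (Real.exp (-(lam * u))) *
      P.map (X u.toNNReal) (Metric.ball 0 r)) (𝓝[>] 0) (𝓝 0) := by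
  have hμ := hX.isConvSemigroup
  have := hμ.prob
  have hmeas : ∀ r : ℝ, Measurable fun u : ℝ => P.map (X u.toNNReal) (Metric.ball 0 r) :=
    fun r => (Measure.measurable_coe measurableSet_ball).comp
      (hμ.measurable.comp measurable_real_toNNReal)
  have hlim : Tendsto (fun r : ℝ => ∫⁻ u in Ioi (0 : ℝ), ENNReal.ofReal (Real.exp (-(lam * u))) *
      P.map (X u.toNNReal) (Metric.ball 0 r)) (𝓝[>] 0) (𝓝 (∫⁻ _ in Ioi (0 : ℝ), 0)) := by
    refine tendsto_lintegral_filter_of_dominated_convergence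
      (fun u => ENNReal.ofReal (Real.exp (-(lam * u)))) ?_ ?_ ?_ ?_
    · exact Eventually.of_forall fun r => (by fun_prop : Measurable fun u : ℝ =>
        ENNReal.ofReal (Real.exp (-(lam * u)))).mul (hmeas r)
    · exact Eventually.of_forall fun r => ae_of_all _ fun u => mul_le_of_le_one_right' prob_le_one
    · have hi := integrableOn_exp_mul_Ioi (a := -lam) (by linarith) 0
      have := hi.lintegral_lt_top
      simpa [neg_mul] using this.ne
    · have hnull : ∀ᵐ u : ℝ ∂(volume.restrict (Ioi 0)), P.map (X u.toNNReal) {0} = 0 := by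
        rw [ae_restrict_iff' measurableSet_Ioi]
        have hc := (h.image ((↑) : ℝ≥0 → ℝ)).measure_zero volume
        filter_upwards [measure_eq_zero_iff_ae_notMem.1 hc] with u hu hu0
        by_contra hne
        exact hu ⟨u.toNNReal, hne, Real.coe_toNNReal u (le_of_lt hu0)⟩
      filter_upwards [hnull] with u hu
      have h1 := tendsto_measure_biInter_gt (μ := P.map (X u.toNNReal)) (a := (0 : ℝ))
        (s := fun r => Metric.ball (0 : E d) r) (fun r _ => measurableSet_ball.nullMeasurableSet)
        (fun i j _ hij => Metric.ball_subset_ball hij) ⟨1, one_pos, measure_ne_top _ _⟩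
      have h2 : ⋂ r > (0 : ℝ), Metric.ball (0 : E d) r = {0} := by
        ext z
        simp only [mem_iInter, mem_ball_zero_iff, mem_singleton_iff]
        refine ⟨fun hz => ?_, fun hz r hr => by simpa [hz] using hr⟩
        by_contra hne
        exact lt_irrefl _ (hz ‖z‖ (norm_pos_iff.2 hne))
      rw [h2, hu] at h1
      have h3 := ENNReal.Tendsto.const_mul (a := ENNReal.ofReal (Real.exp (-(lam * u)))) h1
        (.inr ENNReal.ofReal_ne_top)
      rwa [mul_zero] at h3
  simpa using hlim

theorem boundedBorel_subset_spaceKatoClass (hX : IsLevyProcess P X)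
    (h : ¬ IsCompoundPoisson P X) {lam : ℝ} (hlam : 0 < lam) :
    boundedBorel d ⊆ spaceKatoClass P X lam := by
  rintro q ⟨hqm, M, hM⟩
  have hc : {t : ℝ≥0 | P.map (X t) {0} ≠ 0}.Countable := by
    by_contra hc
    exact h (isCompoundPoisson_of_not_countable hX hc)
  refine ⟨hqm, ?_⟩
  have hlim := ENNReal.Tendsto.const_mul (a := ENNReal.ofReal M)
    (tendsto_setLIntegral_measure_ball hX hc hlam) (.inr ENNReal.ofReal_ne_top)
  rw [mul_zero] at hlim
  refine tendsto_of_tendsto_of_tendsto_of_le_of_le tendsto_const_nhds hlim (fun _ => zero_le) ?_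
  intro r
  refine iSup_le fun x => ?_
  simp only
  rw [potentialOp_top_eq hX.measurable (hqm.enorm.indicator measurableSet_ball),
    ← lintegral_const_mul' _ _ ENNReal.ofReal_ne_top]
  refine lintegral_mono fun u => ?_
  rw [mul_left_comm]
  gcongr
  rw [transOp, ← setLIntegral_const, ← lintegral_indicator measurableSet_ball]
  refine lintegral_mono fun y => ?_
  by_cases hy : y ∈ Metric.ball (0 : E d) r
  · rw [indicator_of_mem hy]
    refine (indicator_le_self _ _ _).trans ?_
    rw [← ofReal_norm]
    exact ENNReal.ofReal_le_ofReal (hM _)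
  · have : x + y ∉ Metric.ball x r := by simpa [mem_ball_iff_norm] using hy
    rw [indicator_of_notMem this]
    exact zero_le

end NonPoisson
end KatoLevy

theorem mainTheorem8 {d : ℕ} {Ω : Type*} [MeasurableSpace Ω]
    (P : Measure Ω) [IsProbabilityMeasure P]
    (X : ℝ≥0 → Ω → KatoLevy.E d) (hX : KatoLevy.IsLevyProcess P X)
    (lam : ℝ) (hlam : 0 < lam) :
    (KatoLevy.spaceKatoClass P X lam ⊆ KatoLevy.timeKatoClass P X ∧
      KatoLevy.timeKatoClass P X ⊆ KatoLevy.unifLocL1 d) ∧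
    KatoLevy.boundedBorel d ⊆ KatoLevy.timeKatoClass P X ∧
    (¬ KatoLevy.IsCompoundPoisson P X →
      KatoLevy.boundedBorel d ⊆ KatoLevy.spaceKatoClass P X lam) ∧
    (KatoLevy.IsCompoundPoisson P X →
      KatoLevy.spaceKatoClass P X lam = {0} ∧
      KatoLevy.timeKatoClass P X = KatoLevy.boundedBorel d) :=
  ⟨⟨KatoLevy.spaceKatoClass_subset_timeKatoClass hX hlam,
      KatoLevy.timeKatoClass_subset_unifLocL1 hX⟩,
    KatoLevy.boundedBorel_subset_timeKatoClass hX,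
    fun h => KatoLevy.boundedBorel_subset_spaceKatoClass hX h hlam,
    fun h => ⟨h.spaceKatoClass_eq hX lam, h.timeKatoClass_eq hX⟩⟩
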